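/- Let $d\ge 1$ and let $\Omega\subset\mathbb R^d$ be a bounded $C^1$-domain, that is, a non-empty, bounded, open, connected set such that every $z\in\partial\Omega$ has an open neighbourhood $U$, an isometry $\phi$ of $\mathbb R^d$ onto $\mathbb R^{d-1}\times\mathbb R$ and a $C^1$-function $\gamma:\mathbb R^{d-1}\to\mathbb R$ such that, for $x\in U$ and $\phi(x)=(x',x_d)$, one has $x\in\Omega$ if and only if $x_d<\gamma(x')$. Let $\vec n$ be the outward unit normal vector field on $\partial\Omega$, let $\mathcal H^{d-1}$ be the $(d-1)$-dimensional Hausdorff measure with its usual normalization (it agrees with Lebesgue measure on $(d-1)$-dimensional planes, and is counting measure for $d=1$), and let $\sigma_{d-1}$ be the restriction of $\mathcal H^{d-1}$ to $\partial\Omega$. For $\varepsilon\in(0,1)$ and $h\in\mathbb R^d$ put $$\alpha_\varepsilon(h)=\varepsilon^{-1}\mathbf 1_{B_\varepsilon(0)}(h),\qquad \mu_\varepsilon(h)=\frac{d(d+2)}{\mathcal H^{d-1}(\mathbb S^{d-1})}\,\varepsilon^{-d-1}\,\mathbf 1_{B_\varepsilon(0)}(h).$$ Let $F\in C^1(\overline\Omega;\mathbb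 R^d)$, and let $\tilde F:\mathbb R^d\to\mathbb R^d$ be any continuous, compactly supported extension of $F$ (for instance a compactly supported $C^1$-extension). Let $$f_\varepsilon(x,y)=\alpha_\varepsilon(x-y)\int_0^1\tilde F\big(x+t(y-x)\big)\cdot(y-x)\,\mathrm dt ,\qquad x,y\in\mathbb R^d,$$ be the nonlocal vector field generated by $F$ (so $f_\varepsilon(x,x)=0$), and let $$\mathcal N_\varepsilon f_\varepsilon(x)=-2\int_\Omega f_\varepsilon(x,y)\,\mu_\varepsilon(y-x)\,\mathrm dy ,\qquad x\in\Omega^c,$$ be its nonlocal normal derivative. Then, for every $\varepsilon\in(0,1)$, the integral defining $\mathcal N_\varepsilon f_\varepsilon(x)$ converges absolutely for every $x\in\Omega^c$, the function $\mathcal N_\varepsilon f_\varepsilon$ is integrable on $\Omega^c$, the function $F\cdot\vec n$ is $\sigma_{d-1}$-integrable on $\partial\Omega$, and $$\int_{\Omega^c}\mathcal N_\varepsilon f_\varepsilon(x)\,\mathrm dx\;\longrightarrow\;\int_{\partial\Omega}F(x)\cdot\vec n(x)\,\mathrm d\sigma_{d-1}(x)\qquad\text{as }\varepsilon\to0^+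 .$$ -/

import Mathlib

open MeasureTheory Set Filter Topology

noncomputable section

namespace NonlocalDivergence

/-- Near `z`, the set `Ω` is, after a rigid motion `φ` of `ℝ^d` onto `ℝ^{d-1} × ℝ` (with the
Euclidean product norm), the region strictly below the graph of a `C¹` function `γ`, and the
complement of `Ω` is the region on or above that graph. -/
def HasC1GraphAt {d : ℕ} (Ω : Set (EuclideanSpace ℝ (Fin d))) (z : EuclideanSpace ℝ (Fin d)) :
    Prop :=
  ∃ (φ : EuclideanSpace ℝ (Fin d) ≃ᵃⁱ[ℝ] WithLp 2 (EuclideanSpace ℝ (Fin (d - 1)) × ℝ))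
    (γ : EuclideanSpace ℝ (Fin (d - 1)) → ℝ) (U : Set (EuclideanSpace ℝ (Fin d))),
    ContDiff ℝ 1 γ ∧ IsOpen U ∧ z ∈ U ∧ ∀ x ∈ U, (x ∈ Ω ↔ (φ x).snd < γ (φ x).fst)

/-- Bounded `C¹`-domains: bounded, open, connected, with boundary locally a `C¹` graph. -/
structure IsBoundedC1Domain {d : ℕ} (Ω : Set (EuclideanSpace ℝ (Fin d))) : Prop where
  isOpen : IsOpen Ω
  isConnected : IsConnected Ω
  isBounded : Bornology.IsBounded Ω
  hasC1GraphAt : ∀ z ∈ frontier Ω, HasC1GraphAt Ω z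

/-- `ν` is the outward unit normal vector of `Ω` at `z`: outside of every cone around the
hyperplane through `z` orthogonal to `ν`, and close to `z`, the points on the side of `-ν` lie in
`Ω` and the points on the side of `ν` do not. -/
def IsOutwardUnitNormal {d : ℕ} (Ω : Set (EuclideanSpace ℝ (Fin d)))
    (z ν : EuclideanSpace ℝ (Fin d)) : Prop :=
  ‖ν‖ = 1 ∧ ∀ δ > 0, ∀ᶠ x in 𝓝 z,
    (inner ℝ (x - z) ν < -(δ * ‖x - z‖) → x ∈ Ω) ∧ (δ * ‖x - z‖ < inner ℝ (x - z) ν → x ∉ Ω)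

open Classical in
/-- The outward unit normal vector `n(z)` (zero where there is none). See
`IsOutwardUnitNormal.unique` and `IsBoundedC1Domain.isOutwardUnitNormal_outwardNormal`. -/
def outwardNormal {d : ℕ} (Ω : Set (EuclideanSpace ℝ (Fin d))) (z : EuclideanSpace ℝ (Fin d)) :
    EuclideanSpace ℝ (Fin d) :=
  if h : ∃ ν, IsOutwardUnitNormal Ω z ν then h.choose else 0

theorem IsOutwardUnitNormal.unique {d : ℕ} {Ω : Set (EuclideanSpace ℝ (Fin d))}
    {z ν ν' : EuclideanSpace ℝ (Fin d)} (h : IsOutwardUnitNormal Ω z ν)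
    (h' : IsOutwardUnitNormal Ω z ν') : ν = ν' := by
  by_contra hne
  have hc : inner ℝ ν ν' < 1 := by
    refine lt_of_le_of_ne ?_ fun he => hne ?_
    · simpa [h.1, h'.1] using real_inner_le_norm ν ν'
    · exact (inner_eq_one_iff_of_norm_eq_one h.1 h'.1).1 he
  set c : ℝ := inner ℝ ν ν' with hcdef
  set v := ν' - ν with hv
  have hv0 : 0 < ‖v‖ := norm_pos_iff.2 (sub_ne_zero.2 (Ne.symm hne))
  have h1 : inner ℝ v ν = c - 1 := by
    rw [hv, inner_sub_left, real_inner_self_eq_norm_sq, h.1, real_inner_comm]; simp [hcdef]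
  have h2 : inner ℝ v ν' = 1 - c := by
    rw [hv, inner_sub_left, real_inner_self_eq_norm_sq, h'.1]; simp [hcdef]
  have hδ : 0 < (1 - c) / (2 * ‖v‖) := by have := sub_pos.2 hc; positivity
  have htend : Tendsto (fun t : ℝ => z + t • v) (𝓝[>] 0) (𝓝 z) := by
    have : Continuous fun t : ℝ => z + t • v := by fun_prop
    simpa using (this.tendsto 0).mono_left nhdsWithin_le_nhds
  obtain ⟨t, ⟨ha, hb⟩, ht⟩ := ((htend.eventually ((h.2 _ hδ).and (h'.2 _ hδ))).and
    self_mem_nhdsWithin).exists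
  have ht : 0 < t := ht
  have hn : (1 - c) / (2 * ‖v‖) * ‖z + t • v - z‖ = t * ((1 - c) / 2) := by
    rw [add_sub_cancel_left, norm_smul, Real.norm_of_nonneg ht.le]; field_simp
  have hpos : 0 < t * ((1 - c) / 2) := mul_pos ht (by linarith)
  refine hb.2 ?_ (ha.1 ?_)
  · rw [hn, add_sub_cancel_left, inner_smul_left, h2]; simp only [conj_trivial]; nlinarith
  · rw [hn, add_sub_cancel_left, inner_smul_left, h1]; simp only [conj_trivial]; nlinarith

theorem HasC1GraphAt.exists_isOutwardUnitNormal {d : ℕ} {Ω : Set (EuclideanSpace ℝ (Fin d))}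
    {z : EuclideanSpace ℝ (Fin d)} (hΩ : IsOpen Ω) (hz : z ∈ frontier Ω) (h : HasC1GraphAt Ω z) :
    ∃ ν, IsOutwardUnitNormal Ω z ν := by
  obtain ⟨φ, γ, U, hγ, hU, hzU, hφ⟩ := h
  have hUz : U ∈ 𝓝 z := hU.mem_nhds hzU
  have hfst : Continuous fun x => (φ x).fst :=
    (WithLp.prod_continuous_ofLp 2 _ _).fst.comp φ.continuous
  have hsnd : Continuous fun x => (φ x).snd :=
    (WithLp.prod_continuous_ofLp 2 _ _).snd.comp φ.continuous
  have hgr : (φ z).snd = γ (φ z).fst := by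
    refine le_antisymm ?_ ?_
    · by_contra hlt
      have hev : ∀ᶠ x in 𝓝 z, x ∉ Ω := by
        filter_upwards [hUz, (hγ.continuous.comp hfst).continuousAt.eventually_lt
          hsnd.continuousAt (not_le.1 hlt)] with x hx hlt' hxΩ
        exact lt_asymm hlt' ((hφ x hx).1 hxΩ)
      obtain ⟨x, hx, hx'⟩ := (mem_closure_iff_frequently.1 hz.1).and_eventually hev |>.exists
      exact hx' hx
    · by_contra hlt
      exact hz.2 (hΩ.interior_eq.symm ▸ (hφ z hzU).2 (not_le.1 hlt))
  set L := fderiv ℝ γ (φ z).fst with hL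
  set g := (InnerProductSpace.toDual ℝ (EuclideanSpace ℝ (Fin (d - 1)))).symm L with hg
  set m : WithLp 2 (EuclideanSpace ℝ (Fin (d - 1)) × ℝ) := WithLp.toLp 2 (-g, 1) with hm
  have hm1 : 1 ≤ ‖m‖ := by
    rw [WithLp.prod_norm_eq_of_L2]
    refine Real.one_le_sqrt.2 ?_
    have h1 : ‖m.snd‖ ^ 2 = 1 := by simp [hm]
    rw [h1]
    exact le_add_of_nonneg_left (sq_nonneg _)
  have hm0 : 0 < ‖m‖ := by linarith
  refine ⟨φ.linearIsometryEquiv.symm (‖m‖⁻¹ • m), ?_, fun δ hδ => ?_⟩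
  · rw [LinearIsometryEquiv.norm_map, norm_smul, norm_inv, norm_norm, inv_mul_cancel₀ hm0.ne']
  have hd : (fun p => γ p - γ (φ z).fst - L (p - (φ z).fst)) =o[𝓝 (φ z).fst]
      fun p => p - (φ z).fst :=
    ((hγ.differentiable one_ne_zero) _).hasFDerivAt.isLittleO
  filter_upwards [hUz, hfst.continuousAt.eventually (hd.def hδ)] with x hx hxd
  have hinner : inner ℝ (x - z) (φ.linearIsometryEquiv.symm (‖m‖⁻¹ • m)) =
      ‖m‖⁻¹ * ((φ x).snd - (φ z).snd - L ((φ x).fst - (φ z).fst)) := by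
    rw [← φ.linearIsometryEquiv.inner_map_map, LinearIsometryEquiv.apply_symm_apply,
      inner_smul_right]
    congr 1
    have h1 : φ.linearIsometryEquiv (x - z) = φ x - φ z := φ.map_vsub x z
    rw [h1, WithLp.prod_inner_apply]
    have h2 : inner ℝ ((φ x).fst - (φ z).fst) g = L ((φ x).fst - (φ z).fst) := by
      rw [real_inner_comm, hg, InnerProductSpace.toDual_symm_apply]
    simp only [hm, WithLp.ofLp_sub, Prod.fst_sub, Prod.snd_sub, inner_neg_right]
    change -inner ℝ ((φ x).fst - (φ z).fst) g + inner ℝ ((φ x).snd - (φ z).snd) (1 : ℝ) = _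
    rw [h2]
    simp
    ring
  have hle : ‖(φ x).fst - (φ z).fst‖ ≤ ‖x - z‖ := by
    have h1 : ‖φ x - φ z‖ = ‖x - z‖ := by
      rw [← dist_eq_norm, φ.dist_map, dist_eq_norm]
    rw [← h1, WithLp.prod_norm_eq_of_L2]
    exact Real.le_sqrt_of_sq_le (le_add_of_nonneg_right (sq_nonneg _))
  rw [Real.norm_eq_abs, abs_le] at hxd
  set s := (φ x).snd - (φ z).snd - L ((φ x).fst - (φ z).fst) with hs
  have hδn : δ * ‖(φ x).fst - (φ z).fst‖ ≤ δ * ‖x - z‖ := by gcongr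
  have hδm : δ * ‖x - z‖ ≤ ‖m‖ * (δ * ‖x - z‖) := le_mul_of_one_le_left (by positivity) hm1
  have hsm : s = ‖m‖ * (‖m‖⁻¹ * s) := by field_simp
  constructor
  · intro hlt
    rw [hinner] at hlt
    have := mul_lt_mul_of_pos_left hlt hm0
    rw [← hsm] at this
    refine (hφ x hx).2 ?_
    linarith [hxd.1]
  · intro hlt hxΩ
    rw [hinner] at hlt
    have := mul_lt_mul_of_pos_left hlt hm0
    rw [← hsm] at this
    have := (hφ x hx).1 hxΩ
    linarith [hxd.2]

theorem IsBoundedC1Domain.isOutwardUnitNormal_outwardNormal {d : ℕ}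
    {Ω : Set (EuclideanSpace ℝ (Fin d))} (hΩ : IsBoundedC1Domain Ω)
    {z : EuclideanSpace ℝ (Fin d)} (hz : z ∈ frontier Ω) :
    IsOutwardUnitNormal Ω z (outwardNormal Ω z) := by
  have h := (hΩ.hasC1GraphAt z hz).exists_isOutwardUnitNormal hΩ.isOpen hz
  rw [outwardNormal, dif_pos h]
  exact h.choose_spec

/-- The nonlocal vector field
`f_α(x, y) = α(x - y) ∫₀¹ F(x + t (y - x)) · (y - x) dt` generated by `F`; its value is `0` for
`x = y`, since then the inner product vanishes. -/
def nonlocalField {d : ℕ} (α : EuclideanSpace ℝ (Fin d) → ℝ)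
    (F : EuclideanSpace ℝ (Fin d) → EuclideanSpace ℝ (Fin d)) (x y : EuclideanSpace ℝ (Fin d)) :
    ℝ :=
  α (x - y) * ∫ t in (0 : ℝ)..1, inner ℝ (F (x + t • (y - x))) (y - x)

/-- The nonlocal normal operator `N_μ f(x) = -2 ∫_Ω f(x, y) μ(y - x) dy`. -/
def nonlocalNormal {d : ℕ} (Ω : Set (EuclideanSpace ℝ (Fin d)))
    (μ : EuclideanSpace ℝ (Fin d) → ℝ)
    (f : EuclideanSpace ℝ (Fin d) → EuclideanSpace ℝ (Fin d) → ℝ)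
    (x : EuclideanSpace ℝ (Fin d)) : ℝ :=
  -2 * ∫ y in Ω, f x y * μ (y - x)

/-- `α_ε = ε⁻¹ 1_{B_ε(0)}`. -/
def alphaKernel (d : ℕ) (ε : ℝ) : EuclideanSpace ℝ (Fin d) → ℝ :=
  (Metric.ball 0 ε).indicator fun _ => ε⁻¹

/-- `μ_ε = d (d + 2) / H^{d-1}(S^{d-1}) ε^{-d-1} 1_{B_ε(0)}`, where `H^{d-1}` is the Hausdorff
measure with the usual normalization (`μHE`, which agrees with Lebesgue measure on
`(d - 1)`-dimensional Euclidean spaces). -/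
def muKernel (d : ℕ) (ε : ℝ) : EuclideanSpace ℝ (Fin d) → ℝ :=
  (Metric.ball 0 ε).indicator fun _ =>
    (d * (d + 2) : ℝ) / (μHE[d - 1] : Measure (EuclideanSpace ℝ (Fin d))).real (Metric.sphere 0 1) *
      (ε ^ (d + 1))⁻¹

end NonlocalDivergence

end

/-! Everything rests on the translation average `v k = ∫ z in Ω, F (z + k)`, with `F` continuous and
compactly supported. Translating `F` amounts to translating `Ω`, so `v` is differentiable at `0`,
with derivative `T k = ∫_{∂Ω} (n · k) F` (`hasFDerivAt_setIntegral_comp_add`). The trace of `T` is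
the flux `∫_{∂Ω} F · n` (`sum_inner_fluxDeriv`).

Write `S(x, h)` for the line integral of `F` from `x` to `x + h`. By Fubini, with `h = y - x`, the
integral of the nonlocal normal derivative is a constant times the integral over `h ∈ B_ε` of minus
the total of `S(x, h)` over segments that start outside `Ω` and end inside. The ball is symmetric,
so `h` may be paired with `-h`. Since `S(x + h, -h) = -S(x, h)`, segments with both ends in `Ω`
cancel, and the paired quantity is `∫_Ω S(x, h) dx + ∫_Ω S(x, -h) dx` (`crossingIntegral_add_neg`).
As `∫_Ω S(x, h) dx = ∫₀¹ v(t h) · h dt`, the expansion of `v` at `0` turns this sum into `T h · h +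
o(‖h‖²)`: the terms `± v 0 · h` cancel (`abs_segmentIntegral_sub_le`).

Integrating `T h · h` over the ball gives `tr T · |B_1| ε^(d+2) / (d+2)` by symmetry. Because
`H^{d-1}(S^{d-1}) = d |B_1|`, the constants in the kernels normalize this to exactly `tr T`.

The derivative of `v` is computed locally. Under a graph, Fubini reduces it to the fundamental
theorem of calculus in the vertical variable; the area formula for graphs converts the result into a
Hausdorff integral; a partition of unity glues the pieces. The sphere identity is the same
derivative formula applied to the unit ball and the identity field. -/

namespace NonlocalDivergence

open scoped NNReal ENNReal

/-! ### Hausdorff measure on `C¹` graphs. -/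

section

theorem muHE_image_le {X Y Z : Type*} [EMetricSpace Y] [MeasurableSpace Y] [BorelSpace Y]
    [EMetricSpace Z] [MeasurableSpace Z] [BorelSpace Z] {f : X → Y} {g : X → Z} {s : Set X}
    {K : ℝ≥0} (h : ∀ a ∈ s, ∀ b ∈ s, edist (f a) (f b) ≤ K * edist (g a) (g b)) (n : ℕ) :
    (μHE[n] : Measure Y) (f '' s) ≤ (K : ℝ≥0∞) ^ n * (μHE[n] : Measure Z) (g '' s) := by
  rcases s.eq_empty_or_nonempty with rfl | ⟨a, ha⟩
  · simp
  have : Nonempty X := ⟨a⟩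
  -- The hypothesis makes `g a ↦ f a` well defined and `K`-Lipschitz on `g '' s`; a choice of
  -- preimages realizes it.
  have hlip : LipschitzOnWith K (f ∘ Function.invFunOn g s) (g '' s) := by
    rintro _ ⟨a, ha, rfl⟩ _ ⟨b, hb, rfl⟩
    have h1 := Function.invFunOn_mem (f := g) (s := s) ⟨a, ha, rfl⟩
    have h2 := Function.invFunOn_mem (f := g) (s := s) ⟨b, hb, rfl⟩
    have h1' := Function.invFunOn_eq (f := g) (s := s) ⟨a, ha, rfl⟩
    have h2' := Function.invFunOn_eq (f := g) (s := s) ⟨b, hb, rfl⟩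
    have := h _ h1 _ h2
    rwa [h1', h2'] at this
  have himg : (f ∘ Function.invFunOn g s) '' (g '' s) = f '' s := by
    rw [image_image]
    refine image_congr fun a ha => ?_
    have h1 := Function.invFunOn_mem (f := g) (s := s) ⟨a, ha, rfl⟩
    have h1' := Function.invFunOn_eq (f := g) (s := s) ⟨a, ha, rfl⟩
    have := h _ h1 _ ha
    rw [h1', edist_self, mul_zero, nonpos_iff_eq_zero, edist_eq_zero] at this
    exact this
  have := hlip.hausdorffMeasure_image_le (d := n) (by positivity)
  rw [himg, ENNReal.rpow_natCast] at this
  simp_rw [Measure.euclideanHausdorffMeasure_def, Measure.smul_apply, Measure.nnreal_smul_coe_apply]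
  rw [mul_left_comm]
  gcongr

variable {d n : ℕ}

/-- The parametrization `x ↦ φ⁻¹ (x, γ x)` of the graph of `γ` in the coordinates `φ`. -/
noncomputable def graphParam (φ : EuclideanSpace ℝ (Fin d) ≃ᵃⁱ[ℝ] WithLp 2 (EuclideanSpace ℝ
    (Fin n) × ℝ))
    (γ : EuclideanSpace ℝ (Fin n) → ℝ) (x : EuclideanSpace ℝ (Fin n)) :
    EuclideanSpace ℝ (Fin d) := φ.symm (WithLp.toLp 2 (x, γ x))

/-- The linear map `x ↦ (x, l x)`. -/
noncomputable def graphLin (l : EuclideanSpace ℝ (Fin n) →L[ℝ] ℝ) :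
    EuclideanSpace ℝ (Fin n) →L[ℝ] WithLp 2 (EuclideanSpace ℝ (Fin n) × ℝ) :=
  (WithLp.prodContinuousLinearEquiv 2 ℝ (EuclideanSpace ℝ (Fin n)) ℝ).symm.toContinuousLinearMap ∘L
    ((ContinuousLinearMap.id ℝ _).prod l)

theorem graphLin_apply (l : EuclideanSpace ℝ (Fin n) →L[ℝ] ℝ) (x) :
    graphLin l x = WithLp.toLp 2 (x, l x) := rfl

theorem norm_le_norm_graphLin (l : EuclideanSpace ℝ (Fin n) →L[ℝ] ℝ) (x) :
    ‖x‖ ≤ ‖graphLin l x‖ := by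
  rw [graphLin_apply, WithLp.prod_norm_eq_of_L2]
  exact Real.le_sqrt_of_sq_le (le_add_of_nonneg_right (sq_nonneg _))

/-- The Gram operator is the identity plus the rank-one map `x ↦ l x • v`, where `v` represents `l`;
its determinant is `1 + l v`. -/
theorem normDet_graphLin (l : EuclideanSpace ℝ (Fin n) →L[ℝ] ℝ) :
    (graphLin l).toLinearMap.normDet = √(1 + ‖l‖ ^ 2) := by
  set v := (InnerProductSpace.toDual ℝ (EuclideanSpace ℝ (Fin n))).symm l with hv
  have key : ((graphLin l).adjoint ∘L graphLin l).toLinearMap =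
      LinearMap.transvection (l : EuclideanSpace ℝ (Fin n) →ₗ[ℝ] ℝ) v := by
    ext1 x
    refine ext_inner_right ℝ fun y => ?_
    have h : ∀ y, inner ℝ v y = l y := fun y => InnerProductSpace.toDual_symm_apply
    simp [LinearMap.transvection, ContinuousLinearMap.adjoint_inner_left, graphLin_apply,
        inner_add_left, inner_smul_left, h, WithLp.prod_inner_apply]
    ring
  have h2 := (graphLin l).normDet_sq
  rw [ContinuousLinearMap.det, key, LinearMap.transvection.det] at h2
  have h3 : l v = ‖l‖ ^ 2 := by
    have h4 : inner ℝ v v = l v := InnerProductSpace.toDual_symm_apply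
    rw [← h4, real_inner_self_eq_norm_sq, hv, LinearIsometryEquiv.norm_map]
  have h5 : (graphLin l).toLinearMap.normDet ^ 2 = 1 + ‖l‖ ^ 2 := by
    rw [← h3]; exact h2
  rw [← h5, Real.sqrt_sq (LinearMap.normDet_nonneg _)]

theorem dist_graphParam
    (φ : EuclideanSpace ℝ (Fin d) ≃ᵃⁱ[ℝ] WithLp 2 (EuclideanSpace ℝ (Fin n) × ℝ))
    (γ : EuclideanSpace ℝ (Fin n) → ℝ) (a b : EuclideanSpace ℝ (Fin n)) :
    dist (graphParam φ γ a) (graphParam φ γ b) = ‖WithLp.toLp 2 (a - b, γ a - γ b)‖ := by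
  rw [graphParam, graphParam, φ.symm.dist_map, dist_eq_norm]
  rfl

theorem continuous_graphParam
    (φ : EuclideanSpace ℝ (Fin d) ≃ᵃⁱ[ℝ] WithLp 2 (EuclideanSpace ℝ (Fin n) × ℝ))
    {γ : EuclideanSpace ℝ (Fin n) → ℝ} (hγ : Continuous γ) : Continuous (graphParam φ γ) :=
  φ.symm.continuous.comp ((WithLp.prod_continuous_toLp 2 _ _).comp (continuous_id.prodMk hγ))

theorem isClosedEmbedding_graphParam
    (φ : EuclideanSpace ℝ (Fin d) ≃ᵃⁱ[ℝ] WithLp 2 (EuclideanSpace ℝ (Fin n) × ℝ))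
    {γ : EuclideanSpace ℝ (Fin n) → ℝ} (hγ : Continuous γ) :
    IsClosedEmbedding (graphParam φ γ) := by
  have h : Function.LeftInverse (fun x => (φ x).fst) (graphParam φ γ) := fun x => by
    simp [graphParam]
  exact h.isClosedEmbedding ((WithLp.prod_continuous_ofLp 2 _ _).fst.comp φ.continuous)
    (continuous_graphParam φ hγ)

/-- The surface element of the graph of `γ`. -/
noncomputable def graphDensity (γ : EuclideanSpace ℝ (Fin n) → ℝ) (x : EuclideanSpace ℝ (Fin n)) :
    ℝ := √(1 + ‖fderiv ℝ γ x‖ ^ 2)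

theorem graphDensity_pos (γ : EuclideanSpace ℝ (Fin n) → ℝ) (x : EuclideanSpace ℝ (Fin n)) :
    0 < graphDensity γ x := Real.sqrt_pos.2 (by positivity)

theorem continuous_graphDensity {γ : EuclideanSpace ℝ (Fin n) → ℝ} (hγ : ContDiff ℝ 1 γ) :
    Continuous (graphDensity γ) := by
  have := hγ.continuous_fderiv one_ne_zero
  unfold graphDensity
  fun_prop

/-- Strict differentiability makes the graph and its tangent plane comparable near `x`:
corresponding distances differ by a factor between `1 - c` and `1 + c`. Lipschitz comparison in both
directions transfers this to `n`-dimensional measure, which is known exactly on the linear image. -/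
theorem exists_ball_muHE_graphParam_image
    (φ : EuclideanSpace ℝ (Fin d) ≃ᵃⁱ[ℝ] WithLp 2 (EuclideanSpace ℝ (Fin n) × ℝ))
    {γ : EuclideanSpace ℝ (Fin n) → ℝ} (hγ : ContDiff ℝ 1 γ) (x : EuclideanSpace ℝ (Fin n))
    {c : ℝ} (hc0 : 0 < c) (hc1 : c < 1) :
    ∃ r > 0, ∀ A ⊆ Metric.ball x r,
      ENNReal.ofReal ((1 - c) ^ n * graphDensity γ x) * volume A ≤
        (μHE[n] : Measure (EuclideanSpace ℝ (Fin d))) (graphParam φ γ '' A) ∧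
      (μHE[n] : Measure (EuclideanSpace ℝ (Fin d))) (graphParam φ γ '' A) ≤
        ENNReal.ofReal ((1 + c) ^ n * graphDensity γ x) * volume A := by
  set l := fderiv ℝ γ x with hl
  have hs : HasStrictFDerivAt γ l x := hγ.contDiffAt.hasStrictFDerivAt one_ne_zero
  have h1 := hs.isLittleO.def hc0
  obtain ⟨r, hr, hball⟩ := Metric.eventually_nhds_iff_ball.1 h1
  have hcomp : ∀ a ∈ Metric.ball x r, ∀ b ∈ Metric.ball x r,
      |dist (graphParam φ γ a) (graphParam φ γ b) - dist (graphLin l a) (graphLin l b)| ≤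
        c * dist (graphLin l a) (graphLin l b) := by
    intro a ha b hb
    have h2 := hball (a, b) (by
      rw [← ball_prod_same]; exact ⟨ha, hb⟩)
    simp only at h2
    rw [dist_graphParam, dist_eq_norm (graphLin l a), ← map_sub]
    calc _ ≤ ‖WithLp.toLp 2 (a - b, γ a - γ b) - graphLin l (a - b)‖ := abs_norm_sub_norm_le _ _
      _ = ‖γ a - γ b - l (a - b)‖ := by
        rw [graphLin_apply, WithLp.prod_norm_eq_of_L2]
        simp [Real.sqrt_sq_eq_abs]
      _ ≤ c * ‖a - b‖ := h2
      _ ≤ _ := by gcongr; exact norm_le_norm_graphLin _ _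
  have hL : ∀ A : Set (EuclideanSpace ℝ (Fin n)),
      (μHE[n] : Measure (WithLp 2 (EuclideanSpace ℝ (Fin n) × ℝ))) (graphLin l '' A) =
        ENNReal.ofReal (graphDensity γ x) * volume A := by
    intro A
    have := (graphLin l).toLinearMap.euclideanHausdorffMeasure_image_eq_normDet_mul_volume A
    rw [normDet_graphLin, finrank_euclideanSpace_fin] at this
    exact this
  refine ⟨r, hr, fun A hA => ⟨?_, ?_⟩⟩
  · have h3 := muHE_image_le (f := graphLin l) (g := graphParam φ γ) (s := A)
      (K := Real.toNNReal (1 - c)⁻¹) (fun a ha b hb => by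
        have := abs_le.1 (hcomp a (hA ha) b (hA hb))
        rw [edist_dist, edist_dist, ← ENNReal.ofReal, ← ENNReal.ofReal_mul (by simp; linarith)]
        refine ENNReal.ofReal_le_ofReal ?_
        rw [inv_mul_eq_div, le_div_iff₀ (by linarith)]
        linarith [this.1]) n
    rw [hL] at h3
    rw [ENNReal.ofReal_mul (by have := sub_pos.2 hc1; positivity), mul_assoc]
    refine (mul_le_mul_right h3 _).trans (le_of_eq ?_)
    rw [← mul_assoc, ← ENNReal.ofReal, ← ENNReal.ofReal_pow (by simp; linarith),
        ← ENNReal.ofReal_mul (by have := sub_pos.2 hc1; positivity),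
      ← mul_pow, mul_inv_cancel₀ (by linarith)]
    simp
  · have h3 := muHE_image_le (f := graphParam φ γ) (g := graphLin l) (s := A)
      (K := Real.toNNReal (1 + c)) (fun a ha b hb => by
        have := abs_le.1 (hcomp a (hA ha) b (hA hb))
        rw [edist_dist, edist_dist, ← ENNReal.ofReal, ← ENNReal.ofReal_mul (by positivity)]
        refine ENNReal.ofReal_le_ofReal ?_
        linarith [this.2]) n
    rwa [hL, ← mul_assoc, ← ENNReal.ofReal, ← ENNReal.ofReal_pow (by positivity),
      ← ENNReal.ofReal_mul (by positivity)] at h3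

/-- Differentiation of measures: the local two-sided bounds give local finiteness and absolute
continuity, and trap the limit of the ratios on small balls between `(1 - c)^n` and `(1 + c)^n`
times the density, for every `c ∈ (0, 1)`. -/
theorem comap_graphParam_muHE
    (φ : EuclideanSpace ℝ (Fin d) ≃ᵃⁱ[ℝ] WithLp 2 (EuclideanSpace ℝ (Fin n) × ℝ))
    {γ : EuclideanSpace ℝ (Fin n) → ℝ} (hγ : ContDiff ℝ 1 γ) :
    Measure.comap (graphParam φ γ) (μHE[n] : Measure (EuclideanSpace ℝ (Fin d))) =
      volume.withDensity fun x => ENNReal.ofReal (graphDensity γ x) := by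
  have hemb := (isClosedEmbedding_graphParam φ hγ.continuous).measurableEmbedding
  set ρ := Measure.comap (graphParam φ γ) (μHE[n] : Measure (EuclideanSpace ℝ (Fin d))) with hρ
  have hρA : ∀ A, ρ A = (μHE[n] : Measure (EuclideanSpace ℝ (Fin d))) (graphParam φ γ '' A) :=
    fun A => hemb.comap_apply _ A
  have hfin : IsLocallyFiniteMeasure ρ := by
    refine ⟨fun x => ?_⟩
    obtain ⟨r, hr, h⟩ := exists_ball_muHE_graphParam_image φ hγ x (c := 1 / 2) (by norm_num)
        (by norm_num)
    refine ⟨Metric.ball x r, Metric.ball_mem_nhds _ hr, ?_⟩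
    rw [hρA]
    exact (h _ subset_rfl).2.trans_lt (ENNReal.mul_lt_top ENNReal.ofReal_lt_top measure_ball_lt_top)
  have hac : ρ ≪ volume := by
    intro A hA
    refine measure_null_of_locally_null A fun x _ => ?_
    obtain ⟨r, hr, h⟩ := exists_ball_muHE_graphParam_image φ hγ x (c := 1 / 2) (by norm_num)
        (by norm_num)
    refine ⟨A ∩ Metric.ball x r, inter_mem_nhdsWithin _ (Metric.ball_mem_nhds _ hr), ?_⟩
    rw [hρA, ← nonpos_iff_eq_zero]
    refine (h _ inter_subset_right).2.trans (le_of_eq ?_)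
    rw [measure_mono_null inter_subset_left hA, mul_zero]
  rw [← Measure.withDensity_rnDeriv_eq ρ volume hac]
  refine withDensity_congr_ae ?_
  filter_upwards [Besicovitch.ae_tendsto_rnDeriv ρ volume] with x hx
  have hbound : ∀ c : ℝ, 0 < c → c < 1 →
      ENNReal.ofReal ((1 - c) ^ n * graphDensity γ x) ≤ ρ.rnDeriv volume x ∧
      ρ.rnDeriv volume x ≤ ENNReal.ofReal ((1 + c) ^ n * graphDensity γ x) := by
    intro c hc0 hc1
    obtain ⟨r, hr, h⟩ := exists_ball_muHE_graphParam_image φ hγ x hc0 hc1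
    have hev : ∀ᶠ t in 𝓝[>] (0 : ℝ), t ∈ Ioo 0 r := Ioo_mem_nhdsGT hr
    have hpos : ∀ t : ℝ, 0 < t → volume (Metric.closedBall x t) ≠ 0 := fun t ht =>
      (Metric.measure_closedBall_pos _ _ ht).ne'
    have hft : ∀ t : ℝ, volume (Metric.closedBall x t) ≠ ⊤ := fun t => measure_closedBall_lt_top.ne
    constructor
    · refine ge_of_tendsto hx (hev.mono fun t ht => ?_)
      rw [ENNReal.le_div_iff_mul_le (Or.inl (hpos t ht.1)) (Or.inl (hft t)), hρA]
      exact (h _ (Metric.closedBall_subset_ball ht.2)).1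
    · refine le_of_tendsto hx (hev.mono fun t ht => ?_)
      rw [ENNReal.div_le_iff (hpos t ht.1) (hft t), hρA]
      exact (h _ (Metric.closedBall_subset_ball ht.2)).2
  have hev : ∀ᶠ t in 𝓝[>] (0 : ℝ), t ∈ Ioo 0 1 := Ioo_mem_nhdsGT one_pos
  refine le_antisymm ?_ ?_
  · have ht : Tendsto (fun c : ℝ => ENNReal.ofReal ((1 + c) ^ n * graphDensity γ x)) (𝓝[>] 0)
        (𝓝 (ENNReal.ofReal (graphDensity γ x))) := by
      have : Continuous fun c : ℝ => ENNReal.ofReal ((1 + c) ^ n * graphDensity γ x) := 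
        ENNReal.continuous_ofReal.comp (by fun_prop)
      simpa using (this.tendsto 0).mono_left nhdsWithin_le_nhds
    exact ge_of_tendsto ht (hev.mono fun c hc => (hbound c hc.1 hc.2).2)
  · have ht : Tendsto (fun c : ℝ => ENNReal.ofReal ((1 - c) ^ n * graphDensity γ x)) (𝓝[>] 0)
        (𝓝 (ENNReal.ofReal (graphDensity γ x))) := by
      have : Continuous fun c : ℝ => ENNReal.ofReal ((1 - c) ^ n * graphDensity γ x) := 
        ENNReal.continuous_ofReal.comp (by fun_prop)
      simpa using (this.tendsto 0).mono_left nhdsWithin_le_nhds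
    exact le_of_tendsto ht (hev.mono fun c hc => (hbound c hc.1 hc.2).1)

theorem restrict_range_graphParam
    (φ : EuclideanSpace ℝ (Fin d) ≃ᵃⁱ[ℝ] WithLp 2 (EuclideanSpace ℝ (Fin n) × ℝ))
    {γ : EuclideanSpace ℝ (Fin n) → ℝ} (hγ : ContDiff ℝ 1 γ) :
    (μHE[n] : Measure (EuclideanSpace ℝ (Fin d))).restrict (range (graphParam φ γ)) =
      (volume.withDensity fun x => ENNReal.ofReal (graphDensity γ x)).map (graphParam φ γ) := by
  rw [← comap_graphParam_muHE φ hγ,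
    (isClosedEmbedding_graphParam φ hγ.continuous).measurableEmbedding.map_comap]

theorem setIntegral_range_graphParam {E : Type*} [NormedAddCommGroup E] [NormedSpace ℝ E]
    (φ : EuclideanSpace ℝ (Fin d) ≃ᵃⁱ[ℝ] WithLp 2 (EuclideanSpace ℝ (Fin n) × ℝ))
    {γ : EuclideanSpace ℝ (Fin n) → ℝ} (hγ : ContDiff ℝ 1 γ) (f : EuclideanSpace ℝ (Fin d) → E) :
    ∫ z in range (graphParam φ γ), f z ∂(μHE[n] : Measure (EuclideanSpace ℝ (Fin d))) =
      ∫ x, graphDensity γ x • f (graphParam φ γ x) := by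
  rw [restrict_range_graphParam φ hγ,
    (isClosedEmbedding_graphParam φ hγ.continuous).measurableEmbedding.integral_map,
    integral_withDensity_eq_integral_toReal_smul
      (continuous_graphDensity hγ).measurable.ennreal_ofReal (by simp)]
  simp [ENNReal.toReal_ofReal (graphDensity_pos γ _).le]

theorem muHE_graphParam_image_lt_top
    (φ : EuclideanSpace ℝ (Fin d) ≃ᵃⁱ[ℝ] WithLp 2 (EuclideanSpace ℝ (Fin n) × ℝ))
    {γ : EuclideanSpace ℝ (Fin n) → ℝ} (hγ : ContDiff ℝ 1 γ) {K : Set (EuclideanSpace ℝ (Fin n))}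
    (hK : IsCompact K) :
    (μHE[n] : Measure (EuclideanSpace ℝ (Fin d))) (graphParam φ γ '' K) < ⊤ := by
  rw [← (isClosedEmbedding_graphParam φ hγ.continuous).measurableEmbedding.comap_apply,
    comap_graphParam_muHE φ hγ, withDensity_apply' ]
  have := (continuous_graphDensity hγ).continuousOn.integrableOn_compact (μ := volume) hK
  exact this.lintegral_lt_top

end

/-! ### The outward normal and the boundary in graph coordinates. -/

section

variable {d n : ℕ}
  {φ : EuclideanSpace ℝ (Fin d) ≃ᵃⁱ[ℝ] WithLp 2 (EuclideanSpace ℝ (Fin n) × ℝ)}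
  {γ : EuclideanSpace ℝ (Fin n) → ℝ} {U Ω : Set (EuclideanSpace ℝ (Fin d))}

/-- The upward unit normal of the graph of `γ` at the point over `x`, in the coordinates `φ`. -/
noncomputable def graphNormal
    (φ : EuclideanSpace ℝ (Fin d) ≃ᵃⁱ[ℝ] WithLp 2 (EuclideanSpace ℝ (Fin n) × ℝ))
    (γ : EuclideanSpace ℝ (Fin n) → ℝ) (x : EuclideanSpace ℝ (Fin n)) :
    EuclideanSpace ℝ (Fin d) :=
  (graphDensity γ x)⁻¹ • φ.linearIsometryEquiv.symm (WithLp.toLp 2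
    (-(InnerProductSpace.toDual ℝ (EuclideanSpace ℝ (Fin n))).symm (fderiv ℝ γ x), 1))

theorem inner_graphNormal (φ : EuclideanSpace ℝ (Fin d) ≃ᵃⁱ[ℝ] WithLp 2 (EuclideanSpace ℝ
    (Fin n) × ℝ))
    (γ : EuclideanSpace ℝ (Fin n) → ℝ) (x : EuclideanSpace ℝ (Fin n)) (k : EuclideanSpace ℝ
        (Fin d)) :
    inner ℝ k (graphNormal φ γ x) = (graphDensity γ x)⁻¹ *
      ((φ.linearIsometryEquiv k).snd - fderiv ℝ γ x (φ.linearIsometryEquiv k).fst) := by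
  rw [graphNormal, inner_smul_right, ← φ.linearIsometryEquiv.inner_map_map,
    LinearIsometryEquiv.apply_symm_apply, WithLp.prod_inner_apply]
  have h : inner ℝ (φ.linearIsometryEquiv k).fst
      ((InnerProductSpace.toDual ℝ (EuclideanSpace ℝ (Fin n))).symm (fderiv ℝ γ x)) =
      fderiv ℝ γ x (φ.linearIsometryEquiv k).fst := by
    rw [real_inner_comm, InnerProductSpace.toDual_symm_apply]
  rw [inner_neg_right]
  change _ * (-inner ℝ (φ.linearIsometryEquiv k).fst _ +
    inner ℝ (φ.linearIsometryEquiv k).snd (1 : ℝ)) = _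
  rw [h, show ∀ a : ℝ, inner ℝ a (1 : ℝ) = a from fun a => by simp]
  ring

theorem norm_graphNormal (φ : EuclideanSpace ℝ (Fin d) ≃ᵃⁱ[ℝ] WithLp 2 (EuclideanSpace ℝ
    (Fin n) × ℝ))
    (γ : EuclideanSpace ℝ (Fin n) → ℝ) (x : EuclideanSpace ℝ (Fin n)) :
    ‖graphNormal φ γ x‖ = 1 := by
  rw [graphNormal, norm_smul, LinearIsometryEquiv.norm_map, norm_inv,
    Real.norm_of_nonneg (graphDensity_pos γ x).le, WithLp.prod_norm_eq_of_L2]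
  have : √(‖-(InnerProductSpace.toDual ℝ (EuclideanSpace ℝ (Fin n))).symm (fderiv ℝ γ x)‖ ^ 2 +
      ‖(1 : ℝ)‖ ^ 2) = graphDensity γ x := by
    rw [graphDensity, norm_neg, LinearIsometryEquiv.norm_map, add_comm]
    simp
  exact (congrArg _ this).trans (inv_mul_cancel₀ (graphDensity_pos γ x).ne')

theorem continuous_graphNormal (hγ : ContDiff ℝ 1 γ) : Continuous (graphNormal φ γ) := by
  have h1 := hγ.continuous_fderiv one_ne_zero
  refine ((continuous_graphDensity hγ).inv₀ fun x => (graphDensity_pos γ x).ne').smul ?_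
  refine φ.linearIsometryEquiv.symm.continuous.comp ((WithLp.prod_continuous_toLp 2 _ _).comp ?_)
  fun_prop

theorem continuous_fst_coord (φ : EuclideanSpace ℝ (Fin d) ≃ᵃⁱ[ℝ] WithLp 2 (EuclideanSpace ℝ
    (Fin n) × ℝ)) :
    Continuous fun x => (φ x).fst :=
  (WithLp.prod_continuous_ofLp 2 _ _).fst.comp φ.continuous

theorem continuous_snd_coord (φ : EuclideanSpace ℝ (Fin d) ≃ᵃⁱ[ℝ] WithLp 2 (EuclideanSpace ℝ
    (Fin n) × ℝ)) :
    Continuous fun x => (φ x).snd :=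
  (WithLp.prod_continuous_ofLp 2 _ _).snd.comp φ.continuous

theorem graphParam_fst_of_snd_eq {x : EuclideanSpace ℝ (Fin d)} (h : (φ x).snd = γ (φ x).fst) :
    graphParam φ γ (φ x).fst = x := by
  rw [graphParam, ← h, φ.symm_apply_eq]
  rfl

/-- Together with uniqueness, this replaces the chosen vector `outwardNormal` by an explicit formula
that is continuous along the boundary. -/
theorem isOutwardUnitNormal_graphNormal (hγ : ContDiff ℝ 1 γ) (hU : IsOpen U)
    (hφ : ∀ x ∈ U, (x ∈ Ω ↔ (φ x).snd < γ (φ x).fst)) {z : EuclideanSpace ℝ (Fin d)} (hz : z ∈ U)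
    (hgr : (φ z).snd = γ (φ z).fst) :
    IsOutwardUnitNormal Ω z (graphNormal φ γ (φ z).fst) := by
  refine ⟨norm_graphNormal _ _ _, fun δ hδ => ?_⟩
  have hd := ((hγ.differentiable one_ne_zero) (φ z).fst).hasFDerivAt.isLittleO
  filter_upwards [hU.mem_nhds hz,
    (continuous_fst_coord φ).continuousAt.eventually (hd.def hδ)] with x hx hxd
  have h1 : φ.linearIsometryEquiv (x - z) = φ x - φ z := φ.map_vsub x z
  rw [inner_graphNormal, h1]
  have hle : ‖(φ x).fst - (φ z).fst‖ ≤ ‖x - z‖ := by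
    rw [← φ.linearIsometryEquiv.norm_map, h1, WithLp.prod_norm_eq_of_L2]
    exact Real.le_sqrt_of_sq_le (le_add_of_nonneg_right (sq_nonneg _))
  change (_ * ((φ x).snd - (φ z).snd - fderiv ℝ γ (φ z).fst ((φ x).fst - (φ z).fst)) < _ → _) ∧
    (_ < _ * ((φ x).snd - (φ z).snd - fderiv ℝ γ (φ z).fst ((φ x).fst - (φ z).fst)) → _)
  rw [Real.norm_eq_abs, abs_le] at hxd
  have hδn : δ * ‖(φ x).fst - (φ z).fst‖ ≤ δ * ‖x - z‖ := by gcongr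
  have hs0 := graphDensity_pos γ (φ z).fst
  have hs1 : 1 ≤ graphDensity γ (φ z).fst :=
    Real.one_le_sqrt.2 (le_add_of_nonneg_right (sq_nonneg _))
  have hδm : δ * ‖x - z‖ ≤ δ * ‖x - z‖ * graphDensity γ (φ z).fst :=
    le_mul_of_one_le_right (by positivity) hs1
  rw [hφ x hx, inv_mul_eq_div, div_lt_iff₀ hs0, lt_div_iff₀ hs0]
  constructor <;> intro h <;> linarith [hxd.1, hxd.2]

theorem IsOutwardUnitNormal.outwardNormal_eq {z ν : EuclideanSpace ℝ (Fin d)}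
    (h : IsOutwardUnitNormal Ω z ν) : outwardNormal Ω z = ν := by
  have h' : ∃ ν, IsOutwardUnitNormal Ω z ν := ⟨ν, h⟩
  rw [outwardNormal, dif_pos h']
  exact h'.choose_spec.unique h

theorem mem_frontier_iff_of_graph (hγ : Continuous γ) (hΩ : IsOpen Ω) (hU : IsOpen U)
    (hφ : ∀ x ∈ U, (x ∈ Ω ↔ (φ x).snd < γ (φ x).fst)) {z : EuclideanSpace ℝ (Fin d)} (hz : z ∈ U) :
    z ∈ frontier Ω ↔ (φ z).snd = γ (φ z).fst := by
  have hUz := hU.mem_nhds hz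
  rw [hΩ.frontier_eq, Set.mem_sdiff, hφ z hz, not_lt]
  constructor
  · rintro ⟨h1, h2⟩
    refine le_antisymm ?_ h2
    by_contra hlt
    have hev : ∀ᶠ x in 𝓝 z, x ∉ Ω := by
      filter_upwards [hUz, (hγ.comp (continuous_fst_coord φ)).continuousAt.eventually_lt
        (continuous_snd_coord φ).continuousAt (not_le.1 hlt)] with x hx hlt' hxΩ
      exact lt_asymm hlt' ((hφ x hx).1 hxΩ)
    obtain ⟨x, hx, hx'⟩ := (mem_closure_iff_frequently.1 h1).and_eventually hev |>.exists
    exact hx' hx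
  · intro h
    refine ⟨?_, h.ge⟩
    -- A point of the graph is approached from inside `Ω` by lowering its last coordinate.
    set p : ℝ → EuclideanSpace ℝ (Fin d) := fun t => φ.symm (WithLp.toLp 2 ((φ z).fst,
        (φ z).snd - t))
    have hp : Continuous p := φ.symm.continuous.comp
      ((WithLp.prod_continuous_toLp 2 _ _).comp (by fun_prop))
    have hp0 : p 0 = z := by
      simp only [p, sub_zero]
      exact φ.symm_apply_apply z
    have ht : Tendsto p (𝓝[>] 0) (𝓝 z) := by
      have := (hp.tendsto 0).mono_left (nhdsWithin_le_nhds (s := Ioi 0))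
      rwa [hp0] at this
    refine mem_closure_of_tendsto ht ?_
    filter_upwards [ht.eventually hUz, self_mem_nhdsWithin] with t htU ht0
    rw [hφ _ htU]
    simp only [p, AffineIsometryEquiv.apply_symm_apply]
    change (φ z).snd - t < γ (φ z).fst
    rw [h]
    exact sub_lt_self _ (mem_Ioi.1 ht0)

theorem outwardNormal_graphParam (hγ : ContDiff ℝ 1 γ) (hU : IsOpen U)
    (hφ : ∀ x ∈ U, (x ∈ Ω ↔ (φ x).snd < γ (φ x).fst)) {x : EuclideanSpace ℝ (Fin n)}
    (hx : graphParam φ γ x ∈ U) : outwardNormal Ω (graphParam φ γ x) = graphNormal φ γ x := by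
  have h : φ (graphParam φ γ x) = WithLp.toLp 2 (x, γ x) := φ.apply_symm_apply _
  have := isOutwardUnitNormal_graphNormal hγ hU hφ hx (by rw [h]; rfl)
  rw [h] at this
  exact this.outwardNormal_eq

theorem IsBoundedC1Domain.isCompact_frontier (hΩ : IsBoundedC1Domain Ω) : IsCompact (frontier Ω) :=
  Metric.isCompact_of_isClosed_isBounded isClosed_frontier
    (hΩ.isBounded.closure.subset frontier_subset_closure)

theorem IsBoundedC1Domain.continuousOn_outwardNormal (hΩ : IsBoundedC1Domain Ω) :
    ContinuousOn (outwardNormal Ω) (frontier Ω) := by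
  intro z hz
  obtain ⟨φ, γ, U, hγ, hU, hzU, hφ⟩ := hΩ.hasC1GraphAt z hz
  have h : ∀ᶠ x in 𝓝[frontier Ω] z, outwardNormal Ω x = graphNormal φ γ (φ x).fst := by
    filter_upwards [mem_nhdsWithin_of_mem_nhds (hU.mem_nhds hzU), self_mem_nhdsWithin] with x hx hxf
    exact (isOutwardUnitNormal_graphNormal hγ hU hφ hx
      ((mem_frontier_iff_of_graph hγ.continuous hΩ.isOpen hU hφ hx).1 hxf)).outwardNormal_eq
  have hc : Continuous fun x => graphNormal φ γ (φ x).fst :=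
    (continuous_graphNormal hγ).comp (continuous_fst_coord φ)
  exact hc.continuousWithinAt.congr_of_eventuallyEq h (h.self_of_nhdsWithin hz)

theorem IsBoundedC1Domain.muHE_frontier_lt_top (hΩ : IsBoundedC1Domain Ω) :
    (μHE[d - 1] : Measure (EuclideanSpace ℝ (Fin d))) (frontier Ω) < ⊤ := by
  refine hΩ.isCompact_frontier.measure_lt_top_of_nhdsWithin fun z hz => ?_
  obtain ⟨φ, γ, U, hγ, hU, hzU, hφ⟩ := hΩ.hasC1GraphAt z hz
  obtain ⟨r, hr, hrU⟩ := Metric.nhds_basis_closedBall.mem_iff.1 (hU.mem_nhds hzU)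
  refine ⟨frontier Ω ∩ Metric.closedBall z r,
    inter_mem_nhdsWithin _ (Metric.closedBall_mem_nhds _ hr), ?_⟩
  refine (measure_mono ?_).trans_lt (muHE_graphParam_image_lt_top φ hγ
    ((isCompact_closedBall z r).image (continuous_fst_coord φ)))
  rintro x ⟨hxf, hx⟩
  exact ⟨_, mem_image_of_mem _ hx, graphParam_fst_of_snd_eq
    ((mem_frontier_iff_of_graph hγ.continuous hΩ.isOpen hU hφ (hrU hx)).1 hxf)⟩

theorem IsBoundedC1Domain.integrableOn_frontier {E : Type*} [NormedAddCommGroup E]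
    (hΩ : IsBoundedC1Domain Ω) {f : EuclideanSpace ℝ (Fin d) → E} (hf : ContinuousOn f
        (frontier Ω)) :
    IntegrableOn f (frontier Ω) (μHE[d - 1] : Measure (EuclideanSpace ℝ (Fin d))) := by
  obtain ⟨C, hC⟩ := hΩ.isCompact_frontier.exists_bound_of_continuousOn hf
  exact IntegrableOn.of_bound hΩ.muHE_frontier_lt_top
    (hf.aestronglyMeasurable_of_isCompact hΩ.isCompact_frontier hΩ.isCompact_frontier.measurableSet)
    C ((ae_restrict_iff' hΩ.isCompact_frontier.measurableSet).2 (Eventually.of_forall hC))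

end

/-! ### Differentiating an integral over a moving subgraph. -/

section

variable {d n : ℕ} {E : Type*} [NormedAddCommGroup E] [NormedSpace ℝ E]

theorem hasDerivAt_setIntegral_Iio [CompleteSpace E] {f : ℝ → E} (hf : Continuous f) (hfi :
    Integrable f) (r : ℝ) :
    HasDerivAt (fun r => ∫ s in Iio r, f s) (f r) r := by
  have h : (fun r => ∫ s in Iio r, f s) = fun r => (∫ s in Iic 0, f s) + ∫ s in 0..r, f s := by
    ext r
    rw [← intervalIntegral.integral_Iic_sub_Iic hfi.integrableOn hfi.integrableOn,
      integral_Iic_eq_integral_Iio (x := r)]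
    abel
  rw [h]
  exact (intervalIntegral.integral_hasDerivAt_right (hf.intervalIntegrable _ _)
    (hf.stronglyMeasurableAtFilter _ _) hf.continuousAt).const_add _

/-- The region strictly below the translate by `q` of the graph of `γ`. -/
def subgraph (γ : EuclideanSpace ℝ (Fin n) → ℝ) (q : EuclideanSpace ℝ (Fin n) × ℝ) :
    Set (EuclideanSpace ℝ (Fin n) × ℝ) := {p | p.2 < γ (p.1 - q.1) + q.2}

theorem measurableSet_subgraph {γ : EuclideanSpace ℝ (Fin n) → ℝ} (hγ : Continuous γ)
    (q : EuclideanSpace ℝ (Fin n) × ℝ) : MeasurableSet (subgraph γ q) :=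
  (isOpen_lt continuous_snd (by fun_prop)).measurableSet

/-- The derivative at `q` of the integral of `g` over the slice of `subgraph γ q` over `x`. -/
noncomputable def subgraphDeriv (γ : EuclideanSpace ℝ (Fin n) → ℝ) (g : EuclideanSpace ℝ
    (Fin n) × ℝ → E)
    (q : EuclideanSpace ℝ (Fin n) × ℝ) (x : EuclideanSpace ℝ (Fin n)) :
    EuclideanSpace ℝ (Fin n) × ℝ →L[ℝ] E :=
  (ContinuousLinearMap.snd ℝ (EuclideanSpace ℝ (Fin n)) ℝ -
    (fderiv ℝ γ (x - q.1)).comp (ContinuousLinearMap.fst ℝ (EuclideanSpace ℝ (Fin n)) ℝ)).smulRight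
      (g (x, γ (x - q.1) + q.2))

theorem continuous_subgraphDeriv {γ : EuclideanSpace ℝ (Fin n) → ℝ} (hγ : ContDiff ℝ 1 γ)
    {g : EuclideanSpace ℝ (Fin n) × ℝ → E} (hg : Continuous g) :
    Continuous fun p : (EuclideanSpace ℝ (Fin n) × ℝ) × EuclideanSpace ℝ (Fin n) =>
      subgraphDeriv γ g p.1 p.2 := by
  have h1 := hγ.continuous_fderiv one_ne_zero
  have h2 := hγ.continuous
  have h3 : Continuous fun p : (EuclideanSpace ℝ (Fin n) × ℝ) × EuclideanSpace ℝ (Fin n) =>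
    (ContinuousLinearMap.snd ℝ (EuclideanSpace ℝ (Fin n)) ℝ -
    (fderiv ℝ γ (p.2 - p.1.1)).comp (ContinuousLinearMap.fst ℝ (EuclideanSpace ℝ (Fin n)) ℝ)) :=
    continuous_const.sub ((h1.comp (by fun_prop)).clm_comp continuous_const)
  have h4 : Continuous fun p : (EuclideanSpace ℝ (Fin n) × ℝ) × EuclideanSpace ℝ (Fin n) =>
    g (p.2, γ (p.2 - p.1.1) + p.1.2) := hg.comp (by fun_prop)
  exact isBoundedBilinearMap_smulRight.continuous.comp (h3.prodMk h4)

theorem integrable_subgraphDeriv {γ : EuclideanSpace ℝ (Fin n) → ℝ} (hγ : ContDiff ℝ 1 γ)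
    {g : EuclideanSpace ℝ (Fin n) × ℝ → E} (hg : Continuous g) (hgs : HasCompactSupport g) :
    Integrable (subgraphDeriv γ g 0) := by
  have hc : Continuous (subgraphDeriv γ g 0) :=
    (continuous_subgraphDeriv hγ hg).comp
      (g := fun p : (EuclideanSpace ℝ (Fin n) × ℝ) × EuclideanSpace ℝ (Fin n) =>
        subgraphDeriv γ g p.1 p.2)
      (f := fun x => ((0 : EuclideanSpace ℝ (Fin n) × ℝ), x)) (by fun_prop)
  refine hc.integrable_of_hasCompactSupport ?_
  refine HasCompactSupport.intro (hgs.isCompact.image continuous_fst) fun x hx => ?_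
  have : g (x, γ x) = 0 := image_eq_zero_of_notMem_tsupport fun h => hx ⟨_, h, rfl⟩
  simp [subgraphDeriv, this]

/-- By Fubini, `q` enters only through the upper limit of each vertical integral, so the fundamental
theorem of calculus and the chain rule differentiate the slices without differentiating `g`. -/
theorem hasFDerivAt_integral_subgraph [CompleteSpace E] {γ : EuclideanSpace ℝ (Fin n) → ℝ} (hγ :
    ContDiff ℝ 1 γ)
    {g : EuclideanSpace ℝ (Fin n) × ℝ → E} (hg : Continuous g) (hgs : HasCompactSupport g) :
    HasFDerivAt (fun q => ∫ p in subgraph γ q, g p) (∫ x, subgraphDeriv γ g 0 x) 0 := by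
  have hgi : Integrable g := hg.integrable_of_hasCompactSupport hgs
  have hind : ∀ q, Integrable ((subgraph γ q).indicator g) (volume.prod volume) := fun q =>
    hgi.indicator (measurableSet_subgraph hγ.continuous q)
  have hslice : ∀ q x, ∫ r, (subgraph γ q).indicator g (x, r) =
      ∫ r in Iio (γ (x - q.1) + q.2), g (x, r) := by
    intro q x
    rw [← integral_indicator measurableSet_Iio]
    rfl
  have heq : (fun q => ∫ p in subgraph γ q, g p) =
      fun q => ∫ x, ∫ r in Iio (γ (x - q.1) + q.2), g (x, r) := by
    ext q
    rw [← integral_indicator (measurableSet_subgraph hγ.continuous q), Measure.volume_eq_prod,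
      integral_prod _ (hind q)]
    exact integral_congr_ae (Eventually.of_forall fun x => hslice q x)
  have hint : ∀ q : EuclideanSpace ℝ (Fin n) × ℝ,
      Integrable fun x => ∫ r in Iio (γ (x - q.1) + q.2), g (x, r) := fun q => by
    have := (hind q).integral_prod_left
    simpa only [hslice] using this
  rw [heq]
  set K := Prod.fst '' tsupport g with hK
  have hKc : IsCompact K := hgs.isCompact.image continuous_fst
  -- Domination: for `q` in the unit ball the slice derivatives vanish off the compact projection
  -- `K` of the support of `g`, and are bounded on it by compactness.
  obtain ⟨C, hC⟩ := ((isCompact_closedBall (0 : EuclideanSpace ℝ (Fin n) × ℝ) 1).prod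
    hKc).exists_bound_of_continuousOn (continuous_subgraphDeriv hγ hg).continuousOn
  refine hasFDerivAt_integral_of_dominated_of_fderiv_le (F' := subgraphDeriv γ g)
    (bound := K.indicator fun _ => C) (Metric.ball_mem_nhds 0 one_pos)
    (Eventually.of_forall fun q => (hint q).1) (hint 0) (integrable_subgraphDeriv hγ hg hgs).1
    (Eventually.of_forall fun x q hq => ?_) ?_ (Eventually.of_forall fun x q hq => ?_)
  · by_cases hx : x ∈ K
    · rw [indicator_of_mem hx]
      exact hC (q, x) ⟨Metric.ball_subset_closedBall hq, hx⟩
    · rw [indicator_of_notMem hx]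
      have : g (x, γ (x - q.1) + q.2) = 0 := image_eq_zero_of_notMem_tsupport fun h =>
        hx ⟨_, h, rfl⟩
      simp [subgraphDeriv, this]
  · exact (integrable_indicator_iff hKc.measurableSet).2 (integrableOn_const hKc.measure_lt_top.ne)
  · have h1 : HasFDerivAt (fun q : EuclideanSpace ℝ (Fin n) × ℝ => γ (x - q.1) + q.2)
        (ContinuousLinearMap.snd ℝ (EuclideanSpace ℝ (Fin n)) ℝ -
    (fderiv ℝ γ (x - q.1)).comp (ContinuousLinearMap.fst ℝ (EuclideanSpace ℝ (Fin n)) ℝ)) q := by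
      have h2 := ((hγ.differentiable one_ne_zero) (x - q.1)).hasFDerivAt
      have h3 : HasFDerivAt (fun q : EuclideanSpace ℝ (Fin n) × ℝ => x - q.1)
        (-ContinuousLinearMap.fst ℝ (EuclideanSpace ℝ (Fin n)) ℝ) q := hasFDerivAt_fst.const_sub x
      exact ((h2.comp q h3).fun_add hasFDerivAt_snd).congr_fderiv
        (by rw [ContinuousLinearMap.comp_neg]; abel)
    have hx : Continuous fun r => g (x, r) := by fun_prop
    have hxs : HasCompactSupport fun r => g (x, r) :=
      HasCompactSupport.intro (hgs.isCompact.image continuous_snd) fun r hr =>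
        image_eq_zero_of_notMem_tsupport fun h => hr ⟨_, h, rfl⟩
    exact ((hasDerivAt_setIntegral_Iio hx (hx.integrable_of_hasCompactSupport hxs)
      _).hasFDerivAt.comp q h1).congr_fderiv (by ext <;> simp [subgraphDeriv])

end

/-! ### The derivative of `k ↦ ∫ z in Ω, G (z + k)`. -/

section

variable {d n : ℕ} {E : Type*} [NormedAddCommGroup E] [NormedSpace ℝ E]

/-- The coordinates `φ` as a homeomorphism onto the product `ℝⁿ × ℝ`. -/
noncomputable def coordHomeomorph
    (φ : EuclideanSpace ℝ (Fin d) ≃ᵃⁱ[ℝ] WithLp 2 (EuclideanSpace ℝ (Fin n) × ℝ)) :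
    EuclideanSpace ℝ (Fin d) ≃ₜ EuclideanSpace ℝ (Fin n) × ℝ :=
  φ.toHomeomorph.trans (WithLp.prodContinuousLinearEquiv 2 ℝ (EuclideanSpace ℝ
      (Fin n)) ℝ).toHomeomorph

/-- The linear part of `coordHomeomorph`. -/
noncomputable def coordLin
    (φ : EuclideanSpace ℝ (Fin d) ≃ᵃⁱ[ℝ] WithLp 2 (EuclideanSpace ℝ (Fin n) × ℝ)) :
    EuclideanSpace ℝ (Fin d) →L[ℝ] EuclideanSpace ℝ (Fin n) × ℝ :=
  (WithLp.prodContinuousLinearEquiv 2 ℝ (EuclideanSpace ℝ (Fin n)) ℝ).toContinuousLinearMap ∘L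
    φ.linearIsometryEquiv.toContinuousLinearEquiv.toContinuousLinearMap

variable (φ : EuclideanSpace ℝ (Fin d) ≃ᵃⁱ[ℝ] WithLp 2 (EuclideanSpace ℝ (Fin n) × ℝ))

theorem coordHomeomorph_apply (x : EuclideanSpace ℝ (Fin d)) :
    coordHomeomorph φ x = WithLp.ofLp (φ x) := rfl

theorem coordLin_apply (x : EuclideanSpace ℝ (Fin d)) :
    coordLin φ x = WithLp.ofLp (φ.linearIsometryEquiv x) := rfl

theorem coordHomeomorph_sub (x k : EuclideanSpace ℝ (Fin d)) :
    coordHomeomorph φ (x - k) = coordHomeomorph φ x - coordLin φ k := by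
  have h := φ.map_vadd x (-k)
  rw [vadd_eq_add, vadd_eq_add, neg_add_eq_sub] at h
  rw [coordHomeomorph_apply, h, map_neg, neg_add_eq_sub]
  rfl

/-- An isometry preserves `d`-dimensional Hausdorff measure, which is the volume on both sides
because the dimensions agree. -/
theorem measurePreserving_coordHomeomorph : MeasurePreserving (coordHomeomorph φ) := by
  refine (WithLp.volume_preserving_ofLp (EuclideanSpace ℝ (Fin n)) ℝ).comp ?_
  have h1 := φ.toIsometryEquiv.measurePreserving_euclideanHausdorffMeasure d
  rw [EuclideanSpace.euclideanHausdorffMeasure_eq_volume] at h1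
  have h2 := φ.linearIsometryEquiv.toLinearEquiv.finrank_eq
  rw [finrank_euclideanSpace_fin] at h2
  have h3 := InnerProductSpace.euclideanHausdorffMeasure_eq_volume
    (V := WithLp 2 (EuclideanSpace ℝ (Fin n) × ℝ))
  rw [← h2] at h3
  rwa [h3] at h1

/-- The derivative at `0` of `k ↦ ∫_Ω G(z + k) dz`: the flux `k ↦ ∫_{∂Ω} (n · k) G`. -/
noncomputable def fluxDeriv (Ω : Set (EuclideanSpace ℝ (Fin d))) (G : EuclideanSpace ℝ
    (Fin d) → E) :
    EuclideanSpace ℝ (Fin d) →L[ℝ] E :=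
  ∫ z in frontier Ω, (innerSL ℝ (outwardNormal Ω z)).smulRight (G z)
    ∂(μHE[d - 1] : Measure (EuclideanSpace ℝ (Fin d)))

/-- For small `k`, a description of `Ω` valid only in `U` suffices to decide whether `z - k ∈ Ω`
wherever `G z ≠ 0`. -/
theorem eventually_sub_mem {X : Type*} [Zero X] {U : Set (EuclideanSpace ℝ (Fin d))} (hU : IsOpen U)
    {G : EuclideanSpace ℝ (Fin d) → X}
    (hGs : HasCompactSupport G) (hGU : tsupport G ⊆ U) :
    ∀ᶠ k in 𝓝 (0 : EuclideanSpace ℝ (Fin d)), ∀ z, G z ≠ 0 → z - k ∈ U := by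
  obtain ⟨δ, hδ, hsub⟩ := hGs.isCompact.exists_thickening_subset_open hU hGU
  filter_upwards [Metric.ball_mem_nhds 0 hδ] with k hk z hz
  refine hsub (Metric.mem_thickening_iff.2 ⟨z, subset_tsupport _ hz, ?_⟩)
  rw [dist_eq_norm]
  simpa using hk

theorem setIntegral_comp_add (Ω : Set (EuclideanSpace ℝ (Fin d))) (hΩ : MeasurableSet Ω)
    (G : EuclideanSpace ℝ (Fin d) → E) (k : EuclideanSpace ℝ (Fin d)) :
    ∫ z in Ω, G (z + k) = ∫ z, {z | z - k ∈ Ω}.indicator G z := by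
  rw [← integral_indicator hΩ, ← integral_sub_right_eq_self _ k]
  refine integral_congr_ae (Eventually.of_forall fun z => ?_)
  by_cases h : z - k ∈ Ω <;> simp [h]

theorem coordHomeomorph_mem_subgraph (γ : EuclideanSpace ℝ (Fin n) → ℝ) (x k : EuclideanSpace ℝ
    (Fin d)) :
    coordHomeomorph φ x ∈ subgraph γ (coordLin φ k) ↔ (φ (x - k)).snd < γ (φ (x - k)).fst := by
  have h : ∀ y, ((φ y).fst, (φ y).snd) = coordHomeomorph φ y := fun _ => rfl
  have h1 : (φ (x - k)).fst = (coordHomeomorph φ x).1 - (coordLin φ k).1 :=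
    congrArg Prod.fst (coordHomeomorph_sub φ x k)
  have h2 : (φ (x - k)).snd = (coordHomeomorph φ x).2 - (coordLin φ k).2 :=
    congrArg Prod.snd (coordHomeomorph_sub φ x k)
  rw [h1, h2, sub_lt_iff_lt_add]
  rfl

theorem integral_comp_subgraphDeriv {γ : EuclideanSpace ℝ (Fin (d - 1)) → ℝ} (hγ : ContDiff ℝ 1 γ)
    (φ : EuclideanSpace ℝ (Fin d) ≃ᵃⁱ[ℝ] WithLp 2 (EuclideanSpace ℝ (Fin (d - 1)) × ℝ))
    {U Ω : Set (EuclideanSpace ℝ (Fin d))} (hΩ : IsOpen Ω) (hU : IsOpen U)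
    (hφ : ∀ x ∈ U, (x ∈ Ω ↔ (φ x).snd < γ (φ x).fst))
    {G : EuclideanSpace ℝ (Fin d) → E} (hG : Continuous G) (hGs : HasCompactSupport G)
    (hGU : tsupport G ⊆ U) [CompleteSpace E] :
    (∫ x, subgraphDeriv γ (G ∘ (coordHomeomorph φ).symm) 0 x) ∘L coordLin φ = fluxDeriv Ω G := by
  have hg : Continuous (G ∘ (coordHomeomorph φ).symm) := hG.comp (coordHomeomorph φ).symm.continuous
  have hgs : HasCompactSupport (G ∘ (coordHomeomorph φ).symm) :=
    hGs.comp_homeomorph (coordHomeomorph φ).symm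
  have hint := integrable_subgraphDeriv hγ hg hgs
  have h0 : ∀ z, z ∉ U → G z = 0 := fun z hz => image_eq_zero_of_notMem_tsupport fun h => hz (hGU h)
  have h1 := ((ContinuousLinearMap.compL ℝ (EuclideanSpace ℝ (Fin d))
    (EuclideanSpace ℝ (Fin (d - 1)) × ℝ) E).flip (coordLin φ)).integral_comp_comm hint
  simp only [ContinuousLinearMap.flip_apply, ContinuousLinearMap.compL_apply] at h1
  rw [← h1, fluxDeriv]
  -- Since `G` is supported in `U`, where the boundary and the graph coincide, the boundary integral
  -- may be taken over the whole graph.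
  have hset : frontier Ω ∩ U = range (graphParam φ γ) ∩ U := by
    ext z
    refine and_congr_left fun hz => ?_
    rw [mem_frontier_iff_of_graph hγ.continuous hΩ hU hφ hz]
    constructor
    · exact fun h => ⟨_, graphParam_fst_of_snd_eq h⟩
    · rintro ⟨x, rfl⟩
      have h : φ (graphParam φ γ x) = WithLp.toLp 2 (x, γ x) := φ.apply_symm_apply _
      rw [h]; rfl
  set f : EuclideanSpace ℝ (Fin d) → EuclideanSpace ℝ (Fin d) →L[ℝ] E := fun z =>
    (innerSL ℝ (outwardNormal Ω z)).smulRight (G z) with hf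
  have hf0 : ∀ z, z ∉ U → f z = 0 := fun z hz => by
    simp only [hf, h0 z hz]
    ext; simp
  have hr : MeasurableSet (range (graphParam φ γ)) :=
    (isClosedEmbedding_graphParam φ hγ.continuous).isClosed_range.measurableSet
  have e1 := setIntegral_eq_of_subset_of_forall_sdiff_eq_zero (μ := (μHE[d - 1] : Measure
      (EuclideanSpace ℝ (Fin d))))
    (f := f) (s := frontier Ω ∩ U) isClosed_frontier.measurableSet inter_subset_left
    (fun z hz => hf0 z fun h => hz.2 ⟨hz.1, h⟩)
  have e2 := setIntegral_eq_of_subset_of_forall_sdiff_eq_zero (μ := (μHE[d - 1] : Measure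
      (EuclideanSpace ℝ (Fin d))))
    (f := f) (s := range (graphParam φ γ) ∩ U) hr inter_subset_left
    (fun z hz => hf0 z fun h => hz.2 ⟨hz.1, h⟩)
  rw [e1, hset, ← e2, setIntegral_range_graphParam φ hγ]
  refine integral_congr_ae (Eventually.of_forall fun x => ?_)
  ext k
  have hGx : (G ∘ (coordHomeomorph φ).symm) (x, γ x) = G (graphParam φ γ x) := rfl
  by_cases hx : graphParam φ γ x ∈ U
  · have hin := inner_graphNormal φ γ x k
    simp only [hf, outwardNormal_graphParam hγ hU hφ hx, subgraphDeriv, _root_.smul_apply,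
      ContinuousLinearMap.smulRight_apply, innerSL_apply_apply, ContinuousLinearMap.comp_apply]
    -- The surface element cancels the normalization of the normal, leaving the vertical part of `k`
    -- minus `fderiv ℝ γ x` of its horizontal part.
    rw [real_inner_comm, hin, smul_smul, mul_inv_cancel_left₀ (graphDensity_pos γ x).ne']
    simp [← hGx, coordLin_apply]
  · have h := h0 _ hx
    rw [← hGx] at h
    simp only [Function.comp_apply] at h
    simp [hf0 _ hx, subgraphDeriv, h]

theorem hasFDerivAt_setIntegral_of_graph {γ : EuclideanSpace ℝ (Fin (d - 1)) → ℝ} (hγ :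
    ContDiff ℝ 1 γ)
    (φ : EuclideanSpace ℝ (Fin d) ≃ᵃⁱ[ℝ] WithLp 2 (EuclideanSpace ℝ (Fin (d - 1)) × ℝ))
    {U Ω : Set (EuclideanSpace ℝ (Fin d))} (hΩ : IsOpen Ω) (hU : IsOpen U)
    (hφ : ∀ x ∈ U, (x ∈ Ω ↔ (φ x).snd < γ (φ x).fst))
    {G : EuclideanSpace ℝ (Fin d) → E} (hG : Continuous G) (hGs : HasCompactSupport G)
    (hGU : tsupport G ⊆ U) [CompleteSpace E] :
    HasFDerivAt (fun k => ∫ z in Ω, G (z + k)) (fluxDeriv Ω G) 0 := by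
  have hg : Continuous (G ∘ (coordHomeomorph φ).symm) := hG.comp (coordHomeomorph φ).symm.continuous
  have hgs : HasCompactSupport (G ∘ (coordHomeomorph φ).symm) :=
    hGs.comp_homeomorph (coordHomeomorph φ).symm
  have hev : (fun k => ∫ z in Ω, G (z + k)) =ᶠ[𝓝 0]
      (fun q => ∫ p in subgraph γ q, (G ∘ (coordHomeomorph φ).symm) p) ∘ coordLin φ := by
    filter_upwards [eventually_sub_mem hU hGs hGU] with k hk
    rw [setIntegral_comp_add Ω hΩ.measurableSet, Function.comp_apply,
      ← integral_indicator (measurableSet_subgraph hγ.continuous _),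
      ← (measurePreserving_coordHomeomorph φ).integral_comp (coordHomeomorph φ).measurableEmbedding]
    refine integral_congr_ae (Eventually.of_forall fun z => ?_)
    classical
    by_cases hz : G z = 0
    · simp [indicator_apply, hz]
    · have := coordHomeomorph_mem_subgraph φ γ z k
      rw [← hφ _ (hk z hz)] at this
      simp [indicator_apply, this]
  rw [← integral_comp_subgraphDeriv hγ φ hΩ hU hφ hG hGs hGU]
  refine HasFDerivAt.congr_of_eventuallyEq ?_ hev
  refine HasFDerivAt.comp 0 ?_ (coordLin φ).hasFDerivAt
  rw [map_zero]
  exact hasFDerivAt_integral_subgraph hγ hg hgs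

/-- Away from the boundary, small translations do not change the integral, and the flux vanishes. -/
theorem hasFDerivAt_setIntegral_of_disjoint {Ω U : Set (EuclideanSpace ℝ (Fin d))} (hΩ : IsOpen Ω)
    (hU : IsOpen U) (h : U ⊆ Ω ∨ Disjoint U Ω) {G : EuclideanSpace ℝ (Fin d) → E}
    (hGs : HasCompactSupport G) (hGU : tsupport G ⊆ U) :
    HasFDerivAt (fun k => ∫ z in Ω, G (z + k)) (fluxDeriv Ω G) 0 := by
  have hfr : Disjoint U (frontier Ω) := by
    rcases h with h | h
    · exact (disjoint_frontier_iff_isOpen.2 hΩ).symm.mono_left h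
    · exact (h.closure_right hU).mono_right frontier_subset_closure
  have hflux : fluxDeriv Ω G = 0 := by
    refine setIntegral_eq_zero_of_forall_eq_zero fun z hz => ?_
    have : G z = 0 := image_eq_zero_of_notMem_tsupport fun h => hfr.le_bot ⟨hGU h, hz⟩
    ext; simp [this]
  rw [hflux]
  rcases h with h | h
  · refine (hasFDerivAt_const (∫ z, G z) 0).congr_of_eventuallyEq ?_
    filter_upwards [eventually_sub_mem hU hGs hGU] with k hk
    rw [setIntegral_comp_add Ω hΩ.measurableSet]
    refine integral_congr_ae (Eventually.of_forall fun z => ?_)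
    by_cases hz : G z = 0
    · simp [hz]
    · simp [h (hk z hz)]
  · refine (hasFDerivAt_const (0 : E) 0).congr_of_eventuallyEq ?_
    filter_upwards [eventually_sub_mem hU hGs hGU] with k hk
    rw [setIntegral_comp_add Ω hΩ.measurableSet]
    refine integral_eq_zero_of_ae (Eventually.of_forall fun z => ?_)
    by_cases hz : G z = 0
    · simp [hz]
    · have : z - k ∉ Ω := fun hm => h.le_bot ⟨hk z hz, hm⟩
      simp [this]

theorem IsBoundedC1Domain.integrableOn_flux {Ω : Set (EuclideanSpace ℝ (Fin d))}
    (hΩ : IsBoundedC1Domain Ω) {G : EuclideanSpace ℝ (Fin d) → E} (hG : Continuous G) :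
    IntegrableOn (fun z => (innerSL ℝ (outwardNormal Ω z)).smulRight (G z)) (frontier Ω)
      (μHE[d - 1] : Measure (EuclideanSpace ℝ (Fin d))) := by
  refine hΩ.integrableOn_frontier ?_
  exact isBoundedBilinearMap_smulRight.continuous.comp_continuousOn
    (((innerSL ℝ).continuous.comp_continuousOn hΩ.continuousOn_outwardNormal).prodMk
        hG.continuousOn)

/-- Both sides are additive in `G`, so a partition of unity on the support of `G` reduces to fields
supported in a graph chart, in `Ω`, or in the exterior. -/
theorem IsBoundedC1Domain.hasFDerivAt_setIntegral_comp_add [CompleteSpace E]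
    {Ω : Set (EuclideanSpace ℝ (Fin d))}
    (hΩ : IsBoundedC1Domain Ω) {G : EuclideanSpace ℝ (Fin d) → E} (hG : Continuous G)
    (hGs : HasCompactSupport G) :
    HasFDerivAt (fun k => ∫ z in Ω, G (z + k)) (fluxDeriv Ω G) 0 := by
  have hloc : ∀ x, ∃ U : Set (EuclideanSpace ℝ (Fin d)), IsOpen U ∧ x ∈ U ∧
      ∀ G : EuclideanSpace ℝ (Fin d) → E, Continuous G → HasCompactSupport G → tsupport G ⊆ U →
        HasFDerivAt (fun k => ∫ z in Ω, G (z + k)) (fluxDeriv Ω G) 0 := by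
    intro x
    by_cases hx : x ∈ frontier Ω
    · obtain ⟨φ, γ, U, hγ, hU, hxU, hφ⟩ := hΩ.hasC1GraphAt x hx
      exact ⟨U, hU, hxU, fun G hG hGs hGU =>
        hasFDerivAt_setIntegral_of_graph hγ φ hΩ.isOpen hU hφ hG hGs hGU⟩
    · by_cases hx' : x ∈ Ω
      · exact ⟨Ω, hΩ.isOpen, hx', fun G _ hGs hGU =>
          hasFDerivAt_setIntegral_of_disjoint hΩ.isOpen hΩ.isOpen (Or.inl subset_rfl) hGs hGU⟩
      · refine ⟨(closure Ω)ᶜ, isClosed_closure.isOpen_compl, fun h => hx ?_, fun G _ hGs hGU =>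
          hasFDerivAt_setIntegral_of_disjoint hΩ.isOpen isClosed_closure.isOpen_compl
            (Or.inr (disjoint_compl_left.mono_right subset_closure)) hGs hGU⟩
        rw [hΩ.isOpen.frontier_eq]
        exact ⟨h, hx'⟩
  choose U hUo hxU hUG using hloc
  obtain ⟨t, -, ht⟩ := hGs.isCompact.elim_nhds_subcover U fun x _ => (hUo x).mem_nhds (hxU x)
  obtain ⟨f, hfU, hf1, -, hfs⟩ := exists_continuous_sum_one_of_isOpen_isCompact
    (s := fun i : Fin t.card => U (t.equivFin.symm i)) (fun i => hUo _) hGs.isCompact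
    (ht.trans (iUnion₂_subset fun x hx =>
      (by simpa using subset_iUnion (fun i : Fin t.card => U (t.equivFin.symm i)) (t.equivFin ⟨x,
          hx⟩))))
  have hsum : ∀ z, G z = ∑ i, f i z • G z := by
    intro z
    by_cases hz : G z = 0
    · simp [hz]
    · have := hf1 (subset_tsupport _ hz)
      simp only [Finset.sum_apply, Pi.one_apply] at this
      rw [← Finset.sum_smul, this, one_smul]
  have hGi : ∀ i, Continuous fun z => f i z • G z := fun i => (f i).continuous.smul hG
  have hGis : ∀ i, HasCompactSupport fun z => f i z • G z := fun i => (hfs i).smul_right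
  have hd := HasFDerivAt.fun_sum (u := Finset.univ) fun i _ =>
    hUG (t.equivFin.symm i) (fun z => f i z • G z) (hGi i) (hGis i)
      ((tsupport_smul_subset_left (f i) G).trans (hfU i))
  have e1 : (fun k => ∫ z in Ω, G (z + k)) = fun k => ∑ i, ∫ z in Ω, f i (z + k) • G (z + k) := by
    ext k
    rw [← integral_finsetSum]
    · exact integral_congr_ae (Eventually.of_forall fun z => hsum _)
    · exact fun i _ => (((hGi i).integrable_of_hasCompactSupport
          (hGis i)).comp_add_right k).integrableOn
  have e2 : fluxDeriv Ω G = ∑ i, fluxDeriv Ω fun z => f i z • G z := by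
    unfold fluxDeriv
    rw [← integral_finsetSum]
    · refine integral_congr_ae (Eventually.of_forall fun z => ?_)
      ext k
      simp only [ContinuousLinearMap.smulRight_apply, _root_.sum_apply]
      rw [← Finset.smul_sum, ← hsum]
    · exact fun i _ => hΩ.integrableOn_flux (hGi i)
  rw [e1, e2]
  exact hd

end

/-! ### The trace of the flux derivative and the area of the unit sphere. -/

section

variable {d : ℕ}

/-- The trace passes under the integral, where Parseval gives `∑ i, (n · b i) (b i · G) = n · G`. -/
theorem IsBoundedC1Domain.sum_inner_fluxDeriv {Ω : Set (EuclideanSpace ℝ (Fin d))}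
    (hΩ : IsBoundedC1Domain Ω) {G : EuclideanSpace ℝ (Fin d) → EuclideanSpace ℝ (Fin d)}
    (hG : Continuous G) {ι : Type*} [Fintype ι]
    (b : OrthonormalBasis ι ℝ (EuclideanSpace ℝ (Fin d))) :
    ∑ i, inner ℝ (b i) (fluxDeriv Ω G (b i)) = ∫ z in frontier Ω, inner ℝ (G z) (outwardNormal Ω z)
      ∂(μHE[d - 1] : Measure (EuclideanSpace ℝ (Fin d))) := by
  have hint := hΩ.integrableOn_flux hG
  have h : ∀ i, inner ℝ (b i) (fluxDeriv Ω G (b i)) = ∫ z in frontier Ω,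
      inner ℝ (outwardNormal Ω z) (b i) * inner ℝ (b i) (G z)
      ∂(μHE[d - 1] : Measure (EuclideanSpace ℝ (Fin d))) := by
    intro i
    rw [fluxDeriv, ContinuousLinearMap.integral_apply hint, ← integral_inner
        (hint.apply_continuousLinearMap _)]
    refine integral_congr_ae (Eventually.of_forall fun z => ?_)
    simp [inner_smul_right]
  simp_rw [h]
  rw [← integral_finsetSum]
  · refine integral_congr_ae (Eventually.of_forall fun z => ?_)
    simp only
    rw [b.sum_inner_mul_inner, real_inner_comm]
  · intro i _
    refine hΩ.integrableOn_frontier ?_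
    exact (hΩ.continuousOn_outwardNormal.inner continuousOn_const).mul
      (continuousOn_const.inner hG.continuousOn)

theorem isOutwardUnitNormal_ball {z : EuclideanSpace ℝ (Fin d)} (hz : ‖z‖ = 1) :
    IsOutwardUnitNormal (Metric.ball 0 1) z z := by
  refine ⟨hz, fun δ hδ => ?_⟩
  -- In `‖x‖² = 1 + 2 (x - z) · z + ‖x - z‖²`, radius `2 δ` keeps the quadratic term below `2 δ ‖x -
  -- z‖`.
  filter_upwards [Metric.closedBall_mem_nhds z (mul_pos two_pos hδ)] with x hx
  rw [mem_closedBall_iff_norm] at hx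
  have h : ‖x‖ ^ 2 = ‖x - z‖ ^ 2 + 2 * inner ℝ (x - z) z + 1 := by
    have := norm_add_sq_real (x - z) z
    rw [sub_add_cancel, hz] at this
    linarith
  have h0 := norm_nonneg (x - z)
  constructor
  · intro hlt
    rw [mem_ball_zero_iff, ← sq_lt_one_iff₀ (norm_nonneg _), h]
    nlinarith
  · intro hlt hmem
    rw [mem_ball_zero_iff, ← sq_lt_one_iff₀ (norm_nonneg _), h] at hmem
    nlinarith [mul_nonneg hδ.le h0]

theorem exists_linearIsometryEquiv_apply_eq {V W : Type*} [NormedAddCommGroup V]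
    [InnerProductSpace ℝ V] [FiniteDimensional ℝ V] [NormedAddCommGroup W] [InnerProductSpace ℝ W]
    [FiniteDimensional ℝ W] (h : Module.finrank ℝ V = Module.finrank ℝ W) {v : V} {w : W}
    (hvw : ‖v‖ = ‖w‖) : ∃ e : V ≃ₗᵢ[ℝ] W, e v = w := by
  let e := (stdOrthonormalBasis ℝ V).equiv (stdOrthonormalBasis ℝ W) (finCongr h)
  refine ⟨e.trans (ℝ ∙ (e v - w))ᗮ.reflection, ?_⟩
  exact Submodule.reflection_sub (by rw [e.norm_map, hvw])

theorem hasC1GraphAt_ball (hd : 1 ≤ d) {z : EuclideanSpace ℝ (Fin d)} (hz : ‖z‖ = 1) :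
    HasC1GraphAt (Metric.ball 0 1) z := by
  obtain ⟨e, he⟩ := exists_linearIsometryEquiv_apply_eq
    (V := EuclideanSpace ℝ (Fin d)) (W := WithLp 2 (EuclideanSpace ℝ (Fin (d - 1)) × ℝ)) (by
      rw [(WithLp.linearEquiv 2 ℝ (EuclideanSpace ℝ (Fin (d - 1)) × ℝ)).finrank_eq]
      simp
      omega) (v := z) (w := WithLp.toLp 2 (0, 1)) (by rw [hz, WithLp.prod_norm_eq_of_L2]; simp)
  -- The bump makes `√(1 - ‖x‖²)` globally `C¹`: it equals `1` for `‖x‖ ≤ 1/2`, where the chart is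
  -- used, and vanishes before the radicand can reach `0`.
  let b : ContDiffBump (0 : EuclideanSpace ℝ (Fin (d - 1))) := ⟨1 / 2, 3 / 4, by norm_num,
      by norm_num⟩
  have hb : ∀ x, 0 < 1 - b x * ‖x‖ ^ 2 := by
    intro x
    by_cases hx : ‖x‖ < 3 / 4
    · have h1 := b.le_one (x := x)
      have h0 := b.nonneg (x := x)
      have h2 : ‖x‖ ^ 2 < 1 := by nlinarith [norm_nonneg x]
      nlinarith [sq_nonneg ‖x‖]
    · rw [b.zero_of_le_dist (by simpa using not_lt.1 hx)]
      norm_num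
  set φ := e.toAffineIsometryEquiv
  refine ⟨φ, fun x => √(1 - b x * ‖x‖ ^ 2), {x | ‖(φ x).fst‖ < 1 / 2 ∧ 0 < (φ x).snd}, ?_, ?_, ?_,
      ?_⟩
  · exact (contDiff_const.sub (b.contDiff.mul (contDiff_norm_sq ℝ))).sqrt fun x => (hb x).ne'
  · exact (isOpen_lt (continuous_fst_coord φ).norm continuous_const).inter
      (isOpen_lt continuous_const (continuous_snd_coord φ))
  · have : φ z = WithLp.toLp 2 (0, 1) := he
    rw [mem_ofPred_eq, this]
    simp
  · rintro x ⟨hx1, hx2⟩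
    have h1 : b (φ x).fst = 1 := b.one_of_mem_closedBall
      (mem_closedBall_zero_iff.2 hx1.le)
    have h2 : ‖x‖ ^ 2 = ‖(φ x).fst‖ ^ 2 + (φ x).snd ^ 2 := by
      rw [← e.norm_map x, WithLp.prod_norm_sq_eq_of_L2]
      simp [φ]
    simp only [h1, one_mul]
    rw [Real.lt_sqrt hx2.le, mem_ball_zero_iff, ← sq_lt_one_iff₀ (norm_nonneg _), h2,
        lt_sub_iff_add_lt']

theorem isBoundedC1Domain_ball (hd : 1 ≤ d) :
    IsBoundedC1Domain (Metric.ball (0 : EuclideanSpace ℝ (Fin d)) 1) where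
  isOpen := Metric.isOpen_ball
  isConnected := ⟨⟨0, by simp⟩, (convex_ball 0 1).isPreconnected⟩
  isBounded := Metric.isBounded_ball
  hasC1GraphAt z hz := hasC1GraphAt_ball hd (by
    rw [frontier_ball _ one_ne_zero] at hz; simpa using hz)

/-- For a field equal to the identity near the closed ball, `v k = v 0 + |B| k` for small `k`, so
the trace is `d |B|`; on the sphere the flux density is `z · z = 1`. -/
theorem muHE_real_sphere (hd : 1 ≤ d) :
    (μHE[d - 1] : Measure (EuclideanSpace ℝ (Fin d))).real (Metric.sphere 0 1) =
      d * (volume : Measure (EuclideanSpace ℝ (Fin d))).real (Metric.ball 0 1) := by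
  have hΩ := isBoundedC1Domain_ball hd
  set B := Metric.ball (0 : EuclideanSpace ℝ (Fin d)) 1 with hB
  -- Inner radius `2` contains `z + k` for all `z` and `k` in the unit ball.
  let b : ContDiffBump (0 : EuclideanSpace ℝ (Fin d)) := ⟨2, 3, by norm_num, by norm_num⟩
  have hG : Continuous fun z => b z • z := b.continuous.smul continuous_id
  have hGs : HasCompactSupport fun z => b z • z := b.hasCompactSupport.smul_right
  have h1 := hΩ.hasFDerivAt_setIntegral_comp_add hG hGs
  have hid : IntegrableOn (fun z => z) B :=
    (continuous_id.continuousOn.integrableOn_compact (isCompact_closedBall 0 1)).mono_set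
      Metric.ball_subset_closedBall
  have hfin : volume B ≠ ⊤ := measure_ball_lt_top.ne
  have hev : (fun k => ∫ z in B, b (z + k) • (z + k)) =ᶠ[𝓝 0]
      fun k => (∫ z in B, z) + volume.real B • k := by
    filter_upwards [Metric.ball_mem_nhds 0 one_pos] with k hk
    have h2 : ∀ z ∈ B, b (z + k) • (z + k) = z + k := by
      intro z hz
      rw [b.one_of_mem_closedBall, one_smul]
      rw [mem_ball_zero_iff] at hk hz
      rw [mem_closedBall_zero_iff]
      refine (norm_add_le _ _).trans ?_
      change ‖z‖ + ‖k‖ ≤ 2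
      linarith
    rw [setIntegral_congr_fun measurableSet_ball h2, integral_add hid (integrableOn_const hfin),
      setIntegral_const]
  have h3 : HasFDerivAt (fun k => ∫ z in B, b (z + k) • (z + k))
      (volume.real B • ContinuousLinearMap.id ℝ (EuclideanSpace ℝ (Fin d))) 0 :=
    (((hasFDerivAt_id 0).const_smul (volume.real B)).const_add _).congr_of_eventuallyEq hev
  have h4 := hΩ.sum_inner_fluxDeriv hG (EuclideanSpace.basisFun (Fin d) ℝ)
  rw [h1.unique h3, frontier_ball _ one_ne_zero] at h4
  have h5 : ∫ z in Metric.sphere (0 : EuclideanSpace ℝ (Fin d)) 1, inner ℝ (b z • z)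
      (outwardNormal B z)
      ∂(μHE[d - 1] : Measure (EuclideanSpace ℝ (Fin d))) =
      ∫ z in Metric.sphere (0 : EuclideanSpace ℝ (Fin d)) 1, (1 : ℝ)
      ∂(μHE[d - 1] : Measure (EuclideanSpace ℝ (Fin d))) := by
    refine setIntegral_congr_fun Metric.isClosed_sphere.measurableSet fun z hz => ?_
    have hz : ‖z‖ = 1 := by simpa using hz
    rw [(isOutwardUnitNormal_ball hz).outwardNormal_eq, b.one_of_mem_closedBall, one_smul,
      real_inner_self_eq_norm_sq, hz, one_pow]
    rw [mem_closedBall_zero_iff, hz]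
    exact one_le_two
  rw [h5, setIntegral_const] at h4
  simpa [inner_smul_right] using h4.symm

theorem inner_reflection_left {V : Type*} [NormedAddCommGroup V]
    [InnerProductSpace ℝ V] [FiniteDimensional ℝ V] (K : Submodule ℝ V) (x y : V) :
    inner ℝ (K.reflection x) y = inner ℝ x (K.reflection y) := by
  rw [← K.reflection.inner_map_map, K.reflection_reflection]

/-! ### Second moments of a ball. -/

section Moments

variable {V : Type*} [NormedAddCommGroup V] [InnerProductSpace ℝ V] [FiniteDimensional ℝ V]
  [MeasurableSpace V] [BorelSpace V]

theorem setIntegral_ball_comp_linearIsometryEquiv {E : Type*} [NormedAddCommGroup E]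
    [NormedSpace ℝ E] (e : V ≃ₗᵢ[ℝ] V) (f : V → E) (r : ℝ) :
    ∫ h in Metric.ball 0 r, f (e h) = ∫ h in Metric.ball 0 r, f h := by
  have := e.measurePreserving.setIntegral_preimage_emb e.toHomeomorph.measurableEmbedding f
    (Metric.ball 0 r)
  rwa [e.preimage_ball, map_zero] at this

/-- The reflection that sends `a` to `-a` and fixes `b` preserves the ball and changes the sign of
the integrand. -/
theorem setIntegral_ball_inner_mul_inner_of_inner_eq_zero {a b : V} (hab : inner ℝ a b = 0) (r :
    ℝ) :
    ∫ h in Metric.ball (0 : V) r, inner ℝ h a * inner ℝ h b = 0 := by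
  have h1 := setIntegral_ball_comp_linearIsometryEquiv (ℝ ∙ a)ᗮ.reflection
    (fun h => inner ℝ h a * inner ℝ h b) r
  have ha : (ℝ ∙ a)ᗮ.reflection a = -a :=
      Submodule.reflection_orthogonalComplement_singleton_eq_neg a
  have hb : (ℝ ∙ a)ᗮ.reflection b = b := Submodule.reflection_mem_subspace_eq_self
    (Submodule.mem_orthogonal_singleton_iff_inner_right.2 hab)
  simp only [inner_reflection_left, ha, hb, inner_neg_right, neg_mul, integral_neg] at h1
  linarith

theorem setIntegral_ball_inner_sq_eq {a b : V} (hab : ‖a‖ = ‖b‖) (r : ℝ) :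
    ∫ h in Metric.ball (0 : V) r, inner ℝ h a ^ 2 = ∫ h in Metric.ball (0 : V) r,
        inner ℝ h b ^ 2 := by
  have h1 := setIntegral_ball_comp_linearIsometryEquiv (ℝ ∙ (b - a))ᗮ.reflection
    (fun h => inner ℝ h b ^ 2) r
  simp only [inner_reflection_left, Submodule.reflection_sub hab.symm] at h1
  exact h1

theorem integrableOn_ball_of_continuous {E : Type*} [NormedAddCommGroup E] {f : V → E}
    (hf : Continuous f) (r : ℝ) : IntegrableOn f (Metric.ball 0 r) :=
  (hf.continuousOn.integrableOn_compact (isCompact_closedBall 0 r)).mono_set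
    Metric.ball_subset_closedBall

/-- Polar coordinates; dimension zero is separate, since they require a nontrivial space. -/
theorem setIntegral_ball_norm_sq {r : ℝ} (hr : 0 ≤ r) :
    ∫ h in Metric.ball (0 : V) r, ‖h‖ ^ 2 = Module.finrank ℝ V *
      (volume.real (Metric.ball (0 : V) 1) * (r ^ (Module.finrank ℝ V + 2) /
          (Module.finrank ℝ V + 2))) := by
  set n := Module.finrank ℝ V with hn
  rcases Nat.eq_zero_or_pos n with h0 | h0
  · have : Subsingleton V := Module.finrank_zero_iff.1 (hn.symm.trans h0)
    have h : ∀ x : V, ‖x‖ ^ 2 = 0 := fun x => by rw [Subsingleton.elim x 0]; simp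
    simp [h, h0]
  have : Nontrivial V := Module.nontrivial_of_finrank_pos (R := ℝ) h0
  have h1 := integral_fun_norm_addHaar (volume : Measure V) ((Iio r).indicator fun y : ℝ => y ^ 2)
  have h2 : ∀ x : V, (Iio r).indicator (fun y : ℝ => y ^ 2) ‖x‖ =
      (Metric.ball (0 : V) r).indicator (fun x => ‖x‖ ^ 2) x := fun x => by
    classical
    simp [indicator_apply]
  have h3 : ∀ y : ℝ, y ^ (n - 1) • (Iio r).indicator (fun y : ℝ => y ^ 2) y =
      (Iio r).indicator (fun y : ℝ => y ^ (n + 1)) y := fun y => by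
    classical
    simp only [indicator_apply, smul_eq_mul, mul_ite, mul_zero, ← pow_add]
    rw [show n - 1 + 2 = n + 1 by omega]
  simp only [h2] at h1
  rw [integral_indicator measurableSet_ball, ← hn] at h1
  simp only [h3] at h1
  rw [setIntegral_indicator measurableSet_Iio, Ioi_inter_Iio, ← integral_Ioc_eq_integral_Ioo,
    ← intervalIntegral.integral_of_le hr, integral_pow] at h1
  rw [h1]
  simp only [nsmul_eq_mul, smul_eq_mul]
  push_cast
  ring

/-- In an orthonormal basis the mixed moments vanish, and the diagonal ones are equal by reflection,
hence each is the integral of `‖h‖²` divided by the dimension. -/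
theorem setIntegral_ball_inner_apply (T : V →L[ℝ] V) {ι : Type*} [Fintype ι]
    (b : OrthonormalBasis ι ℝ V) {r : ℝ} (hr : 0 ≤ r) :
    ∫ h in Metric.ball (0 : V) r, inner ℝ (T h) h = (∑ i, inner ℝ (b i) (T (b i))) *
      (volume.real (Metric.ball (0 : V) 1) * (r ^ (Module.finrank ℝ V + 2) /
          (Module.finrank ℝ V + 2))) := by
  classical
  set M := volume.real (Metric.ball (0 : V) 1) * (r ^ (Module.finrank ℝ V + 2) /
      (Module.finrank ℝ V + 2)) with hM
  have hdiag : ∀ i, ∫ h in Metric.ball (0 : V) r, inner ℝ h (b i) ^ 2 = M := by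
    intro i
    have h1 : ∑ j, ∫ h in Metric.ball (0 : V) r, inner ℝ h (b j) ^ 2 = Module.finrank ℝ V * M := by
      rw [← setIntegral_ball_norm_sq hr, ← integral_finsetSum]
      · refine integral_congr_ae (Eventually.of_forall fun h => ?_)
        simp only
        rw [← b.sum_sq_inner_left h]
      · exact fun j _ => integrableOn_ball_of_continuous (by fun_prop) r
    have h2 : ∀ j, ∫ h in Metric.ball (0 : V) r, inner ℝ h (b j) ^ 2 =
        ∫ h in Metric.ball (0 : V) r, inner ℝ h (b i) ^ 2 := fun j =>
      setIntegral_ball_inner_sq_eq (by simp) r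
    simp only [h2, Finset.sum_const, Finset.card_univ, ← Module.finrank_eq_card_basis b.toBasis,
      nsmul_eq_mul] at h1
    have h3 : (Module.finrank ℝ V : ℝ) ≠ 0 := by
      rw [Module.finrank_eq_card_basis b.toBasis, Nat.cast_ne_zero]
      exact (Fintype.card_pos_iff.2 ⟨i⟩).ne'
    exact mul_left_cancel₀ h3 h1
  have hpt : ∀ h, inner ℝ (T h) h =
      ∑ i, ∑ j, inner ℝ (b j) (T (b i)) * (inner ℝ h (b i) * inner ℝ h (b j)) := by
    intro h
    have h1 : T h = ∑ i, inner ℝ (b i) h • T (b i) := by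
      conv_lhs => rw [← b.sum_repr' h]
      simp
    rw [h1, sum_inner]
    refine Finset.sum_congr rfl fun i _ => ?_
    rw [inner_smul_left, ← b.sum_inner_mul_inner (T (b i)) h, Finset.mul_sum]
    refine Finset.sum_congr rfl fun j _ => ?_
    rw [real_inner_comm (b i) h, real_inner_comm (b j) h, real_inner_comm (b j) (T (b i))]
    simp only [conj_trivial]
    ring
  have hI : ∀ i j, IntegrableOn (fun h => inner ℝ (b j) (T (b i)) * (inner ℝ h (b i) * inner ℝ h
      (b j)))
      (Metric.ball 0 r) := fun i j => integrableOn_ball_of_continuous (by fun_prop) r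
  simp_rw [hpt]
  rw [integral_finsetSum _ fun i _ => integrable_finsetSum _ fun j _ => hI i j, Finset.sum_mul]
  refine Finset.sum_congr rfl fun i _ => ?_
  rw [integral_finsetSum _ fun j _ => hI i j, Finset.sum_eq_single i]
  · rw [integral_const_mul, ← hdiag i]
    simp_rw [sq]
  · intro j _ hji
    rw [integral_const_mul, setIntegral_ball_inner_mul_inner_of_inner_eq_zero, mul_zero]
    rw [b.inner_eq_ite, if_neg hji.symm]
  · simp

end Moments

end

/-! ### Crossing segments and the nonlocal normal derivative. -/

section

variable {d : ℕ} {Ω : Set (EuclideanSpace ℝ (Fin d))}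
  {F : EuclideanSpace ℝ (Fin d) → EuclideanSpace ℝ (Fin d)}

/-- The line integral of `F` along the segment from `x` to `x + h`. -/
noncomputable def segmentIntegral (F : EuclideanSpace ℝ (Fin d) → EuclideanSpace ℝ (Fin d))
    (x h : EuclideanSpace ℝ (Fin d)) : ℝ := ∫ t in (0 : ℝ)..1, inner ℝ (F (x + t • h)) h

theorem continuous_segmentIntegral (hF : Continuous F) :
    Continuous fun p : EuclideanSpace ℝ (Fin d) × EuclideanSpace ℝ (Fin d) =>
      segmentIntegral F p.1 p.2 := by
  unfold segmentIntegral
  refine intervalIntegral.continuous_parametric_intervalIntegral_of_continuous' ?_ 0 1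
  fun_prop

theorem segmentIntegral_add_neg (x h : EuclideanSpace ℝ (Fin d)) :
    segmentIntegral F (x + h) (-h) = -segmentIntegral F x h := by
  have h1 := intervalIntegral.integral_comp_sub_left (a := 0) (b := 1)
    (fun t : ℝ => inner ℝ (F (x + t • h)) h) 1
  rw [sub_self, sub_zero] at h1
  rw [segmentIntegral, segmentIntegral, ← h1, ← intervalIntegral.integral_neg]
  refine intervalIntegral.integral_congr fun t _ => ?_
  simp only [inner_neg_right]
  rw [show x + h + t • -h = x + (1 - t) • h by module]

theorem integrable_indicator_of_isBounded {X E : Type*} [MetricSpace X] [ProperSpace X]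
    [MeasurableSpace X] [BorelSpace X] [SecondCountableTopology X] [NormedAddCommGroup E]
    {μ : Measure X} [IsFiniteMeasureOnCompacts μ] {f : X → E} (hf : Continuous f) {S : Set X}
    (hS : MeasurableSet S) (hb : Bornology.IsBounded S) : Integrable (S.indicator f) μ :=
  (integrable_indicator_iff hS).2 ((hf.continuousOn.integrableOn_compact
    hb.isCompact_closure).mono_set subset_closure)

/-- The integral of `segmentIntegral F x h` over the `x ∉ Ω` with `x + h ∈ Ω`. -/
noncomputable def crossingIntegral (Ω : Set (EuclideanSpace ℝ (Fin d)))
    (F : EuclideanSpace ℝ (Fin d) → EuclideanSpace ℝ (Fin d)) (h : EuclideanSpace ℝ (Fin d)) : ℝ :=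
  ∫ x, {x | x ∉ Ω ∧ x + h ∈ Ω}.indicator (fun x => segmentIntegral F x h) x

theorem crossingIntegral_add_neg (hΩ : MeasurableSet Ω) (hb : Bornology.IsBounded Ω)
    (hF : Continuous F) (h : EuclideanSpace ℝ (Fin d)) :
    crossingIntegral Ω F h + crossingIntegral Ω F (-h) =
      -((∫ x in Ω, segmentIntegral F x h) + ∫ x in Ω, segmentIntegral F x (-h)) := by
  classical
  have hc : Continuous fun x => segmentIntegral F x h :=
    (continuous_segmentIntegral hF).comp (f := fun x => (x, h)) (by fun_prop)
  have hm : MeasurableSet {x | x + h ∈ Ω} := hΩ.preimage (measurable_add_const h)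
  have hmb : Bornology.IsBounded {x | x + h ∈ Ω} := by
    refine (hb.vadd (-h)).subset fun x hx => ⟨x + h, hx, ?_⟩
    simp
  have i1 : Integrable ({x | x ∉ Ω ∧ x + h ∈ Ω}.indicator fun x => segmentIntegral F x h) :=
    integrable_indicator_of_isBounded hc (hΩ.compl.inter hm) (hmb.subset fun x hx => hx.2)
  have i2 : Integrable ({x | x + h ∉ Ω ∧ x ∈ Ω}.indicator fun x => segmentIntegral F x h) :=
    integrable_indicator_of_isBounded hc (hm.compl.inter hΩ) (hb.subset fun x hx => hx.2)
  have i3 : Integrable (Ω.indicator fun x => segmentIntegral F x h) :=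
    integrable_indicator_of_isBounded hc hΩ hb
  have i4 : Integrable ({x | x + h ∈ Ω}.indicator fun x => segmentIntegral F x h) :=
    integrable_indicator_of_isBounded hc hm hmb
  -- Shifting `x` by `h` reverses the segments. What remains is the pointwise identity `1_{x ∉ Ω,
  -- x+h ∈ Ω} - 1_{x ∈ Ω, x+h ∉ Ω} = 1_{x+h ∈ Ω} - 1_{x ∈ Ω}`.
  have e1 : crossingIntegral Ω F (-h) =
      -∫ x, {x | x + h ∉ Ω ∧ x ∈ Ω}.indicator (fun x => segmentIntegral F x h) x := by
    rw [crossingIntegral, ← integral_add_right_eq_self _ h, ← integral_neg]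
    refine integral_congr_ae (Eventually.of_forall fun x => ?_)
    by_cases h1 : x ∈ Ω <;> by_cases h2 : x + h ∈ Ω <;>
      simp [h1, h2, segmentIntegral_add_neg]
  have e2 : ∫ x in Ω, segmentIntegral F x (-h) =
      -∫ x, {x | x + h ∈ Ω}.indicator (fun x => segmentIntegral F x h) x := by
    rw [← integral_indicator hΩ, ← integral_add_right_eq_self _ h, ← integral_neg]
    refine integral_congr_ae (Eventually.of_forall fun x => ?_)
    by_cases h2 : x + h ∈ Ω <;> simp [h2, segmentIntegral_add_neg]
  rw [e1, e2, crossingIntegral, ← integral_indicator hΩ, ← sub_eq_add_neg, ← sub_eq_add_neg,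
    ← integral_sub i1 i2, ← integral_sub i3 i4, ← integral_neg]
  refine integral_congr_ae (Eventually.of_forall fun x => ?_)
  by_cases h1 : x ∈ Ω <;> by_cases h2 : x + h ∈ Ω <;> simp [h1, h2]

theorem setIntegral_segmentIntegral (hb : Bornology.IsBounded Ω)
    (hF : Continuous F) (h : EuclideanSpace ℝ (Fin d)) :
    ∫ x in Ω, segmentIntegral F x h = ∫ t in (0 : ℝ)..1, inner ℝ (∫ x in Ω, F (x + t • h)) h := by
  have hint : ∀ t : ℝ, IntegrableOn (fun x => F (x + t • h)) Ω := fun t =>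
    ((by fun_prop : Continuous fun x => F (x + t • h)).continuousOn.integrableOn_compact
      hb.isCompact_closure).mono_set subset_closure
  have h1 : ∀ t : ℝ, inner ℝ (∫ x in Ω, F (x + t • h)) h = ∫ x in Ω, inner ℝ (F (x + t • h)) h := by
    intro t
    rw [real_inner_comm, ← integral_inner (hint t)]
    simp_rw [real_inner_comm h]
  simp_rw [h1, segmentIntegral, intervalIntegral.integral_of_le zero_le_one]
  refine integral_integral_swap ?_
  rw [Measure.prod_restrict]
  have hc : Continuous fun p : EuclideanSpace ℝ (Fin d) × ℝ => inner ℝ (F (p.1 + p.2 • h)) h := by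
    fun_prop
  exact (hc.continuousOn.integrableOn_compact (hb.isCompact_closure.prod isCompact_Icc)).mono_set
    (prod_mono subset_closure Ioc_subset_Icc_self)

/-- Each of the two integrals is `v 0 · (± h)` plus half of `T h · h`, the half being `∫₀¹ t dt`,
with error at most `δ ‖h‖²`; the odd terms cancel in the sum. -/
theorem abs_segmentIntegral_sub_le {V : Type*} [NormedAddCommGroup V] [InnerProductSpace ℝ V]
    {v : V → V} {T : V →L[ℝ] V} {δ ρ : ℝ} (hv : Continuous v)
    (hT : ∀ k ∈ Metric.ball (0 : V) ρ, ‖v k - v 0 - T k‖ ≤ δ * ‖k‖) {h : V}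
    (hh : h ∈ Metric.ball (0 : V) ρ) (hδ : 0 ≤ δ) :
    |(∫ t in (0 : ℝ)..1, inner ℝ (v (t • h)) h) + (∫ t in (0 : ℝ)..1, inner ℝ (v (t • -h)) (-h)) -
      inner ℝ (T h) h| ≤ 2 * δ * ‖h‖ ^ 2 := by
  have key : ∀ h ∈ Metric.ball (0 : V) ρ, |(∫ t in (0 : ℝ)..1, inner ℝ (v (t • h)) h) -
      (inner ℝ (v 0) h + 2⁻¹ * inner ℝ (T h) h)| ≤ δ * ‖h‖ ^ 2 := by
    intro h hh
    have e : inner ℝ (v 0) h + 2⁻¹ * inner ℝ (T h) h =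
        ∫ t in (0 : ℝ)..1, (inner ℝ (v 0) h + t * inner ℝ (T h) h) := by
      rw [intervalIntegral.integral_add (by simp) ((by fun_prop : Continuous fun t : ℝ =>
        t * inner ℝ (T h) h).intervalIntegrable _ _), intervalIntegral.integral_const,
        intervalIntegral.integral_mul_const, integral_id]
      norm_num
    rw [e, ← intervalIntegral.integral_sub
      ((by fun_prop : Continuous fun t : ℝ => inner ℝ (v (t • h)) h).intervalIntegrable _ _)
      ((by fun_prop : Continuous fun t : ℝ => inner ℝ (v 0) h + t * inner ℝ
          (T h) h).intervalIntegrable _ _)]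
    have := intervalIntegral.norm_integral_le_of_norm_le_const (a := 0) (b := 1)
      (f := fun t : ℝ => inner ℝ (v (t • h)) h - (inner ℝ (v 0) h + t * inner ℝ (T h) h))
      (C := δ * ‖h‖ ^ 2) (fun t ht => by
        rw [uIoc_of_le zero_le_one] at ht
        have h1 : ‖t • h‖ ≤ ‖h‖ := by
          rw [norm_smul, Real.norm_of_nonneg ht.1.le]
          exact mul_le_of_le_one_left (norm_nonneg _) ht.2
        have h2 := hT (t • h) (by
          rw [mem_ball_zero_iff] at hh ⊢; exact h1.trans_lt hh)
        have h3 : inner ℝ (v (t • h)) h - (inner ℝ (v 0) h + t * inner ℝ (T h) h) =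
            inner ℝ (v (t • h) - v 0 - T (t • h)) h := by
          rw [inner_sub_left, inner_sub_left, map_smul, inner_smul_left]
          simp only [conj_trivial]
          ring
        rw [h3]
        calc _ ≤ ‖v (t • h) - v 0 - T (t • h)‖ * ‖h‖ := norm_inner_le_norm _ _
          _ ≤ δ * ‖h‖ * ‖h‖ := by gcongr; exact h2.trans (by gcongr)
          _ = _ := by ring)
    simpa using this
  have k1 := abs_le.1 (key h hh)
  have k2 := abs_le.1 (key (-h) (by simpa using hh))
  simp only [map_neg, inner_neg_neg, norm_neg] at k2
  rw [inner_neg_right (v 0) h] at k2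
  rw [abs_le]
  constructor <;> linarith [k1.1, k1.2, k2.1, k2.2]

theorem nonlocalField_mul_muKernel (ε : ℝ) (x y : EuclideanSpace ℝ (Fin d)) :
    nonlocalField (alphaKernel d ε) F x y * muKernel d ε (y - x) =
      (Metric.ball 0 ε).indicator (fun h => ε⁻¹ * ((d * (d + 2) : ℝ) /
        (μHE[d - 1] : Measure (EuclideanSpace ℝ (Fin d))).real (Metric.sphere 0 1) *
          (ε ^ (d + 1))⁻¹) * segmentIntegral F x h) (y - x) := by
  by_cases h : y - x ∈ Metric.ball (0 : EuclideanSpace ℝ (Fin d)) ε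
  · have h' : x - y ∈ Metric.ball (0 : EuclideanSpace ℝ (Fin d)) ε := by
      rwa [mem_ball_zero_iff, norm_sub_rev, ← mem_ball_zero_iff]
    rw [nonlocalField, muKernel, alphaKernel, indicator_of_mem h, indicator_of_mem h',
      indicator_of_mem h, segmentIntegral]
    ring
  · rw [muKernel, indicator_of_notMem h, indicator_of_notMem h, mul_zero]

theorem integrableOn_nonlocalField_mul_muKernel (hF : Continuous F) (ε : ℝ)
    (x : EuclideanSpace ℝ (Fin d)) (S : Set (EuclideanSpace ℝ (Fin d))) :
    IntegrableOn (fun y => nonlocalField (alphaKernel d ε) F x y * muKernel d ε (y - x)) S := by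
  simp_rw [nonlocalField_mul_muKernel]
  have hc : Continuous fun h => segmentIntegral F x h :=
    (continuous_segmentIntegral hF).comp (f := fun h => (x, h)) (by fun_prop)
  exact ((integrable_indicator_of_isBounded (continuous_const.mul hc) measurableSet_ball
    Metric.isBounded_ball).comp_sub_right x).integrableOn

/-- The pairs `(x, h)` with `x ∉ Ω`, `x + h ∈ Ω` and `‖h‖ < ε`. -/
def crossingSet (Ω : Set (EuclideanSpace ℝ (Fin d))) (ε : ℝ) :
    Set (EuclideanSpace ℝ (Fin d) × EuclideanSpace ℝ (Fin d)) :=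
  {p | (p.1 ∉ Ω ∧ p.1 + p.2 ∈ Ω) ∧ p.2 ∈ Metric.ball 0 ε}

/-- Although `x` ranges over the complement of `Ω`, the crossing set is bounded: `x = (x + h) - h`
lies in `Ω - B_ε`. This justifies every use of Fubini. -/
theorem integrable_crossingSet_indicator (hΩ : MeasurableSet Ω) (hb : Bornology.IsBounded Ω)
    (hF : Continuous F) (ε : ℝ) :
    Integrable ((crossingSet Ω ε).indicator fun p => segmentIntegral F p.1 p.2)
      (volume.prod volume) := by
  refine integrable_indicator_of_isBounded (continuous_segmentIntegral hF) ?_ ?_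
  · exact ((hΩ.compl.preimage measurable_fst).inter (hΩ.preimage
        (measurable_fst.add measurable_snd))).inter
      (measurableSet_ball.preimage measurable_snd)
  · refine ((hb.sub (Metric.isBounded_ball (x := 0) (r := ε))).prod (Metric.isBounded_ball (x :=
        0) (r := ε))).subset ?_
    rintro ⟨x, h⟩ ⟨⟨-, h1⟩, h2⟩
    exact ⟨⟨x + h, h1, h, h2, by simp⟩, h2⟩

theorem indicator_nonlocalNormal (hΩ : MeasurableSet Ω) (ε : ℝ) (x : EuclideanSpace ℝ (Fin d)) :
    Ωᶜ.indicator (nonlocalNormal Ω (muKernel d ε) (nonlocalField (alphaKernel d ε) F)) x =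
      -2 * (ε⁻¹ * ((d * (d + 2) : ℝ) /
        (μHE[d - 1] : Measure (EuclideanSpace ℝ (Fin d))).real (Metric.sphere 0 1) *
          (ε ^ (d + 1))⁻¹)) *
        ∫ h, (crossingSet Ω ε).indicator (fun p => segmentIntegral F p.1 p.2) (x, h) := by
  classical
  by_cases hx : x ∈ Ω
  · have h0 : ∀ h, (crossingSet Ω ε).indicator (fun p => segmentIntegral F p.1 p.2) (x, h) = 0 :=
      fun h => indicator_of_notMem (fun hm => hm.1.1 hx) _
    simp [h0, hx]
  · rw [indicator_of_mem hx, nonlocalNormal, mul_assoc, ← integral_const_mul (ε⁻¹ * _)]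
    simp_rw [nonlocalField_mul_muKernel]
    rw [← integral_indicator hΩ, ← integral_add_left_eq_self _ x]
    refine congrArg (-2 * ·) (integral_congr_ae (Eventually.of_forall fun h => ?_))
    by_cases h1 : x + h ∈ Ω <;> by_cases h2 : h ∈ Metric.ball (0 : EuclideanSpace ℝ (Fin d)) ε
    all_goals
      rw [mem_ball_zero_iff] at h2
      simp [indicator_apply, crossingSet, h1, h2, hx]

theorem integrableOn_nonlocalNormal (hΩ : MeasurableSet Ω) (hb : Bornology.IsBounded Ω)
    (hF : Continuous F) (ε : ℝ) :
    IntegrableOn (nonlocalNormal Ω (muKernel d ε) (nonlocalField (alphaKernel d ε) F)) Ωᶜ := by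
  rw [← integrable_indicator_iff hΩ.compl, funext (indicator_nonlocalNormal hΩ ε)]
  exact (integrable_crossingSet_indicator hΩ hb hF ε).integral_prod_left.const_mul _

theorem integral_crossingSet_indicator (ε : ℝ) (h : EuclideanSpace ℝ (Fin d)) :
    ∫ x, (crossingSet Ω ε).indicator (fun p => segmentIntegral F p.1 p.2) (x, h) =
      (Metric.ball 0 ε).indicator (crossingIntegral Ω F) h := by
  classical
  by_cases hh : h ∈ Metric.ball (0 : EuclideanSpace ℝ (Fin d)) ε
  · rw [indicator_of_mem hh, crossingIntegral]
    refine integral_congr_ae (Eventually.of_forall fun x => ?_)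
    rw [mem_ball_zero_iff] at hh
    simp [indicator_apply, crossingSet, hh]
  · have h0 : ∀ x, (crossingSet Ω ε).indicator (fun p => segmentIntegral F p.1 p.2) (x, h) = 0 :=
      fun x => indicator_of_notMem (fun hm => hh hm.2) _
    rw [indicator_of_notMem hh]
    simp [h0]

theorem integrableOn_crossingIntegral (hΩ : MeasurableSet Ω) (hb : Bornology.IsBounded Ω)
    (hF : Continuous F) (ε : ℝ) : IntegrableOn (crossingIntegral Ω F) (Metric.ball 0 ε) := by
  rw [← integrable_indicator_iff measurableSet_ball]
  have := (integrable_crossingSet_indicator hΩ hb hF ε).integral_prod_right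
  simpa only [integral_crossingSet_indicator] using this

theorem integrableOn_ball_comp_neg {V E : Type*} [NormedAddCommGroup V] [MeasurableSpace V]
    [BorelSpace V] {μ : Measure V} [μ.IsNegInvariant] [NormedAddCommGroup E] {f : V → E} {r : ℝ}
    (hf : IntegrableOn f (Metric.ball 0 r) μ) :
    IntegrableOn (fun h => f (-h)) (Metric.ball 0 r) μ := by
  rw [← integrable_indicator_iff measurableSet_ball] at hf ⊢
  refine hf.comp_neg.congr (Eventually.of_forall fun h => ?_)
  classical
  simp [indicator_apply]

theorem setIntegral_nonlocalNormal (hΩ : MeasurableSet Ω) (hb : Bornology.IsBounded Ω)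
    (hF : Continuous F) (ε : ℝ) :
    ∫ x in Ωᶜ, nonlocalNormal Ω (muKernel d ε) (nonlocalField (alphaKernel d ε) F) x =
      ε⁻¹ * ((d * (d + 2) : ℝ) /
        (μHE[d - 1] : Measure (EuclideanSpace ℝ (Fin d))).real (Metric.sphere 0 1) *
          (ε ^ (d + 1))⁻¹) *
        ∫ h in Metric.ball 0 ε, -(crossingIntegral Ω F h + crossingIntegral Ω F (-h)) := by
  have hint := integrableOn_crossingIntegral hΩ hb hF ε
  -- The factor `2` in the normal operator is spent on symmetrizing in `h`.
  have hneg : ∫ h in Metric.ball 0 ε, crossingIntegral Ω F (-h) =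
      ∫ h in Metric.ball 0 ε, crossingIntegral Ω F h :=
    setIntegral_ball_comp_linearIsometryEquiv (LinearIsometryEquiv.neg ℝ) (crossingIntegral Ω F) ε
  have hint' := integrableOn_ball_comp_neg hint
  rw [← integral_indicator hΩ.compl, funext (indicator_nonlocalNormal hΩ ε), integral_const_mul,
    integral_integral_swap (f := fun x h => (crossingSet Ω ε).indicator
      (fun p => segmentIntegral F p.1 p.2) (x, h)) (integrable_crossingSet_indicator hΩ hb hF ε)]
  simp_rw [integral_crossingSet_indicator]
  rw [integral_indicator measurableSet_ball, integral_neg, integral_add hint hint', hneg]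
  ring

theorem IsBoundedC1Domain.tendsto_setIntegral_nonlocalNormal (hd : 1 ≤ d) (hΩ : IsBoundedC1Domain Ω)
    (hF : Continuous F) (hFs : HasCompactSupport F) :
    Tendsto (fun ε : ℝ => ∫ x in Ωᶜ,
        nonlocalNormal Ω (muKernel d ε) (nonlocalField (alphaKernel d ε) F) x) (𝓝[>] 0)
      (𝓝 (∫ z in frontier Ω, inner ℝ (F z) (outwardNormal Ω z)
        ∂(μHE[d - 1] : Measure (EuclideanSpace ℝ (Fin d))))) := by
  have hm := hΩ.isOpen.measurableSet
  have hb := hΩ.isBounded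
  set v : EuclideanSpace ℝ (Fin d) → EuclideanSpace ℝ (Fin d) := fun k => ∫ z in Ω, F
      (z + k) with hv
  have hvd : HasFDerivAt v (fluxDeriv Ω F) 0 := hΩ.hasFDerivAt_setIntegral_comp_add hF hFs
  have hvc : Continuous v := by
    obtain ⟨C, hC⟩ := hF.bounded_above_of_compact_support hFs
    exact continuous_of_dominated (bound := fun _ => C)
      (fun k => (hF.comp (continuous_add_const k)).aestronglyMeasurable)
      (fun k => Eventually.of_forall fun z => hC _)
      (integrableOn_const hb.measure_lt_top.ne)
      (Eventually.of_forall fun z => hF.comp (continuous_const_add z))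
  rw [← hΩ.sum_inner_fluxDeriv hF (EuclideanSpace.basisFun (Fin d) ℝ)]
  set T := fluxDeriv Ω F
  set β := (volume : Measure (EuclideanSpace ℝ (Fin d))).real (Metric.ball 0 1) with hβ
  have hβ0 : 0 < β := ENNReal.toReal_pos (Metric.measure_ball_pos _ _ one_pos).ne'
    measure_ball_lt_top.ne
  have hd0 : (0 : ℝ) < d := by exact_mod_cast hd
  rw [Metric.tendsto_nhdsWithin_nhds]
  intro η hη
  -- The final error is `2 δ d`, which this choice makes `η / 2`.
  set δ := η / (4 * d) with hδdef
  have hδ : 0 < δ := by positivity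
  have hlo := hvd.isLittleO.def hδ
  obtain ⟨ρ, hρ, hball⟩ := Metric.eventually_nhds_iff_ball.1 hlo
  refine ⟨ρ, hρ, fun {ε} hε hερ => ?_⟩
  have hε0 : 0 < ε := hε
  rw [Real.dist_eq, sub_zero, abs_of_pos hε0] at hερ
  rw [Real.dist_eq, setIntegral_nonlocalNormal hm hb hF, muHE_real_sphere hd, ← hβ]
  have hT := setIntegral_ball_inner_apply T (EuclideanSpace.basisFun (Fin d) ℝ) hε0.le
  have hN := setIntegral_ball_norm_sq (V := EuclideanSpace ℝ (Fin d)) hε0.le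
  rw [finrank_euclideanSpace_fin, ← hβ] at hT hN
  set κ := ε⁻¹ * ((d * (d + 2) : ℝ) / (d * β) * (ε ^ (d + 1))⁻¹) with hκ
  have hκ0 : 0 < κ := by positivity
  -- The sphere area `d β` in the denominator cancels `d`, so `κ` is the reciprocal of the second
  -- moment in each direction.
  have hκ1 : κ * (β * (ε ^ (d + 2) / (d + 2))) = 1 := by
    rw [hκ]; field_simp; ring
  have hsum : ∑ i, inner ℝ (EuclideanSpace.basisFun (Fin d) ℝ i) (T (EuclideanSpace.basisFun
      (Fin d) ℝ i)) =
      κ * ∫ h in Metric.ball 0 ε, inner ℝ (T h) h := by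
    rw [hT, mul_left_comm, hκ1, mul_one]
  have hint : IntegrableOn (fun h => -(crossingIntegral Ω F h + crossingIntegral Ω F (-h)))
      (Metric.ball 0 ε) :=
    have h := integrableOn_crossingIntegral hm hb hF ε
    (h.add (integrableOn_ball_comp_neg h)).neg
  have hTi : IntegrableOn (fun h => inner ℝ (T h) h) (Metric.ball 0 ε) :=
    integrableOn_ball_of_continuous (by fun_prop) ε
  have hni : IntegrableOn (fun h : EuclideanSpace ℝ (Fin d) => 2 * δ * ‖h‖ ^ 2) (Metric.ball 0 ε) :=
    integrableOn_ball_of_continuous (by fun_prop) ε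
  rw [hsum, ← mul_sub, ← integral_sub hint hTi, abs_mul, abs_of_pos hκ0]
  have hle : |∫ h in Metric.ball 0 ε, (-(crossingIntegral Ω F h + crossingIntegral Ω F (-h)) -
      inner ℝ (T h) h)| ≤ ∫ h in Metric.ball (0 : EuclideanSpace ℝ (Fin d)) ε, 2 * δ * ‖h‖ ^ 2 := by
    rw [← Real.norm_eq_abs]
    refine norm_integral_le_of_norm_le hni ((ae_restrict_iff' measurableSet_ball).2
      (Eventually.of_forall fun h hh => ?_))
    rw [Real.norm_eq_abs, crossingIntegral_add_neg hm hb hF, neg_neg,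
        setIntegral_segmentIntegral hb hF,
      setIntegral_segmentIntegral hb hF]
    exact abs_segmentIntegral_sub_le hvc (fun k hk => by simpa using hball k hk)
      (Metric.ball_subset_ball hερ.le hh) hδ.le
  rw [integral_const_mul, hN] at hle
  calc _ ≤ κ * (2 * δ * (d * (β * (ε ^ (d + 2) / (d + 2))))) := by gcongr
    _ = 2 * δ * d * (κ * (β * (ε ^ (d + 2) / (d + 2)))) := by ring
    _ = η / 2 := by rw [hκ1, hδdef]; field_simp; norm_num
    _ < η := half_lt_self hη

end

end NonlocalDivergence

theorem mainTheorem2 (d : ℕ) (hd : 1 ≤ d) (Ω : Set (EuclideanSpace ℝ (Fin d)))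
    (hΩ : NonlocalDivergence.IsBoundedC1Domain Ω)
    (F : EuclideanSpace ℝ (Fin d) → EuclideanSpace ℝ (Fin d))
    (hF : ContDiffOn ℝ 1 F (closure Ω))
    (Fext : EuclideanSpace ℝ (Fin d) → EuclideanSpace ℝ (Fin d))
    (hFext_cont : Continuous Fext) (hFext_supp : HasCompactSupport Fext)
    (hFext : EqOn Fext F (closure Ω)) :
    (∀ ε ∈ Ioo (0 : ℝ) 1,
      (∀ x ∈ Ωᶜ, IntegrableOn (fun y =>
        NonlocalDivergence.nonlocalField (NonlocalDivergence.alphaKernel d ε) Fext x y *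
          NonlocalDivergence.muKernel d ε (y - x)) Ω) ∧
      IntegrableOn (NonlocalDivergence.nonlocalNormal Ω (NonlocalDivergence.muKernel d ε)
        (NonlocalDivergence.nonlocalField (NonlocalDivergence.alphaKernel d ε) Fext)) Ωᶜ) ∧
    IntegrableOn (fun z => inner ℝ (F z) (NonlocalDivergence.outwardNormal Ω z)) (frontier Ω)
      (μHE[d - 1] : Measure (EuclideanSpace ℝ (Fin d))) ∧
    Tendsto (fun ε : ℝ => ∫ x in Ωᶜ,
        NonlocalDivergence.nonlocalNormal Ω (NonlocalDivergence.muKernel d ε)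
          (NonlocalDivergence.nonlocalField (NonlocalDivergence.alphaKernel d ε) Fext) x)
      (𝓝[>] 0)
      (𝓝 (∫ z in frontier Ω, inner ℝ (F z) (NonlocalDivergence.outwardNormal Ω z)
        ∂(μHE[d - 1] : Measure (EuclideanSpace ℝ (Fin d))))) := by
  refine ⟨fun ε _ => ⟨fun x _ => NonlocalDivergence.integrableOn_nonlocalField_mul_muKernel
    hFext_cont ε x Ω, NonlocalDivergence.integrableOn_nonlocalNormal hΩ.isOpen.measurableSet
      hΩ.isBounded hFext_cont ε⟩, hΩ.integrableOn_frontier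
        ((hF.continuousOn.mono frontier_subset_closure).inner hΩ.continuousOn_outwardNormal), ?_⟩
  -- The limit sees the extension only on `∂Ω`, where it agrees with `F`.
  rw [← setIntegral_congr_fun isClosed_frontier.measurableSet fun z hz => congrArg (inner ℝ · _)
    (hFext (frontier_subset_closure hz))]
  exact hΩ.tendsto_setIntegral_nonlocalNormal hd hFext_cont hFext_supp
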